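/- Let $b:\mathbb R^n\to\mathbb R^n$ be $C^1$, let $D$ be a constant symmetric positive semidefinite $n\times n$ matrix, and let $[2D]^{1/2}$ denote a square matrix $G$ with $GG^T=2D$. On a probability space with a standard $n$-dimensional Brownian motion $B$ let, for $0<\epsilon<\epsilon_0$, $X_\epsilon$ solve $$dX_\epsilon=b(X_\epsilon)\,ds+\sqrt{\epsilon}\,[2D]^{1/2}dB ,\qquad s\ge 0 ,$$ with $X_\epsilon(0)$ independent of $B$. Let $\hat x$ solve $\hat x'=b(\hat x)$ on $[0,\infty)$, and let $Z$ solve the linearised equation $$dZ=A(\hat x(s))Z\,ds+[2D]^{1/2}dB ,\qquad A=\text{Jacobian of } b ,$$ with $Z(0)$ independent of $B$, where $Z(0)$ is the limit in probability of $(X_\epsilon(0)-\hat x(0))/\sqrt\epsilon$ as $\epsilon\downarrow0$. Denote by $\Sigma(t)$ the covariance matrix of $Z(t)$. Let $J\subseteq[0,\infty)$ be an interval such that for $s\in J$ the vector $X_\epsilon(s)$ has a probability density $p_\epsilon(\cdot,s)$ which, for times in the interior of $J$, is $C^2$ in $x$, differentiable in time, and solves the Fokker–Planck equation $$\partial_s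 p_\epsilon=-\nabla\cdot\left(b\,p_\epsilon-\epsilon D\nabla p_\epsilon\right).$$ Suppose that for every $s\in J$ the following two expansions hold as $\epsilon\downarrow0$. 1. (Scale of the central limit theorem.) For each $z\in\mathbb R^n$, the rescaled density $\hat p_\epsilon(z,s)=\epsilon^{n/2}p_\epsilon(\hat x(s)+\sqrt\epsilon\,z,\,s)$ satisfies $$\hat p_\epsilon(z,s)=\hat p_0(z,s)+\sqrt\epsilon\,\hat p_1(z,s)+o(\sqrt\epsilon).$$ 2. (WKB.) Uniformly for $x$ in a neighbourhood of $\hat x(s)$, $$p_\epsilon(x,s)=a(\epsilon,s)\exp\Big[-\tfrac1\epsilon\varphi(x,s)+\ln\omega(x,s)+O(\epsilon)\Big],$$ where near $\hat x(s)$ the function $\varphi(\cdot,s)$ is $C^3$ and $\omega(\cdot,s)$ is $C^1$ and positive. Then, for every $t\in J$, the Hessian $\nabla\nabla\varphi(\hat x(t),t)$ is positive definite and $$\Sigma(t)=\left[\nabla\nabla\varphi(\hat x(t),t)\right]^{-1}.$$ Moreover $\Sigma_{ij}(t)=\int_{\mathbb R^n} z_iz_j\,\hat p_0(z,t)\,dz$,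 and the first-moment vector $m_i(t)=\int_{\mathbb R^n} z_i\,\hat p_1(z,t)\,dz$ satisfies $$m(t)=\left[\nabla\nabla\varphi(\hat x(t),t)\right]^{-1}\nabla\ln\omega(\hat x(t),t)-\tfrac16\,\nabla\nabla\nabla\varphi(\hat x(t),t)\,\Theta ,$$ all these integrals being absolutely convergent. Here $$\big(\nabla\nabla\nabla\varphi\,\Theta\big)_i=\sum_{j,k,\ell,\mu,\nu,\rho,\kappa}\varphi'''_{jk\ell}\,\Xi^{1/2}_{i\mu}\Xi^{1/2}_{j\nu}\Xi^{1/2}_{k\rho}\Xi^{1/2}_{\ell\kappa}\,\Theta_{\mu\nu\rho\kappa},$$ $$\Theta_{\mu\nu\rho\kappa}=\int_{\mathbb R^n}\frac{y_\mu y_\nu y_\rho y_\kappa}{(2\pi)^{n/2}}\,e^{-y^Ty/2}\,dy ,$$ where $\Xi=[\nabla\nabla\varphi(\hat x(t),t)]^{-1}$ and $\Xi^{1/2}$ is any matrix with $\Xi^{1/2}(\Xi^{1/2})^T=\Xi$. -/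

import Mathlib

open MeasureTheory ProbabilityTheory Filter Topology Set
open scoped NNReal Matrix

/-- `ℝⁿ` with its Euclidean norm. -/
abbrev Euc (n : ℕ) : Type := EuclideanSpace ℝ (Fin n)

/-! ### Differential operators on `ℝⁿ` -/

/-- The divergence `∇ · F = ∑ i, ∂ᵢ Fᵢ` of a vector field. -/
noncomputable def euclideanDiv {n : ℕ} (F : Euc n → Euc n) (x : Euc n) : ℝ :=
  ∑ i, (fderiv ℝ F x (EuclideanSpace.single i 1)) i

/-- The Hessian matrix `∇∇f(x)`. -/
noncomputable def hessianMatrix {n : ℕ} (f : Euc n → ℝ) (x : Euc n) :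
    Matrix (Fin n) (Fin n) ℝ :=
  Matrix.of fun i j =>
    iteratedFDeriv ℝ 2 f x ![EuclideanSpace.single i 1, EuclideanSpace.single j 1]

/-- The third partial derivatives `f'''_{jkl}(x)`. -/
noncomputable def thirdPartial {n : ℕ} (f : Euc n → ℝ) (x : Euc n) (j k l : Fin n) : ℝ :=
  iteratedFDeriv ℝ 3 f x
    ![EuclideanSpace.single j 1, EuclideanSpace.single k 1, EuclideanSpace.single l 1]

/-! ### The fourth-moment tensor `Θ` and its contraction with third derivatives -/

/-- `Θ_{μνρκ} = ∫ y_μ y_ν y_ρ y_κ (2π)^{-n/2} exp(-yᵀy/2) dy`. -/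
noncomputable def Theta {n : ℕ} (μ ν ρ κ : Fin n) : ℝ :=
  ∫ y : Euc n,
    y μ * y ν * y ρ * y κ / (2 * Real.pi) ^ ((n : ℝ) / 2) * Real.exp (-(‖y‖ ^ 2 / 2))

/-- `(∇∇∇f(x) Θ)_i = ∑ f'''_{jkl}(x) S_{iμ} S_{jν} S_{kρ} S_{lκ} Θ_{μνρκ}`, the sum running over
`j, k, l, μ, ν, ρ, κ`, where the matrix `S` stands for `Ξ^{1/2}`. -/
noncomputable def thirdDerivTheta {n : ℕ} (f : Euc n → ℝ) (x : Euc n)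
    (S : Matrix (Fin n) (Fin n) ℝ) (i : Fin n) : ℝ :=
  ∑ j, ∑ k, ∑ l, ∑ μ, ∑ ν, ∑ ρ, ∑ κ,
    thirdPartial f x j k l * S i μ * S j ν * S k ρ * S l κ * Theta μ ν ρ κ

/-! ### Diffusion processes with constant noise matrix -/

/-- Standard `n`-dimensional Brownian motion: independent coordinates, each of which is a standard
real Brownian motion. -/
structure IsStdBrownian {n : ℕ} {Ω : Type*} [MeasurableSpace Ω] (P : Measure Ω)
    (B : ℝ≥0 → Ω → Euc n) : Prop where
  coord : ∀ i, IsBrownianReal (fun s ω => B s ω i) P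
  indep : iIndepFun (fun (i : Fin n) (ω : Ω) (s : ℝ≥0) => B s ω i) P

/-- `X` solves `dX(s) = f(s, X(s)) ds + G dB(s)` for `s ≥ 0`, with an initial value independent of
the driving Brownian motion. The noise matrix `G` is constant, so the stochastic integral of `G` up
to time `s` is `G B(s)`, and the equation is an identity between paths. -/
structure IsSDESolution {n : ℕ} {Ω : Type*} [MeasurableSpace Ω] (P : Measure Ω)
    (B : ℝ≥0 → Ω → Euc n) (f : ℝ → Euc n → Euc n) (G : Matrix (Fin n) (Fin n) ℝ)
    (X : ℝ → Ω → Euc n) : Prop where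
  aemeasurable : ∀ s, 0 ≤ s → AEMeasurable (X s) P
  indep_init : IndepFun (X 0) (fun ω (s : ℝ≥0) => B s ω) P
  continuous_paths : ∀ᵐ ω ∂P, ContinuousOn (fun s => X s ω) (Ici 0)
  equation : ∀ᵐ ω ∂P, ∀ s : ℝ≥0,
    X s ω = X 0 ω + (∫ r in (0 : ℝ)..s, f r (X r ω)) + Matrix.toEuclideanCLM (𝕜 := ℝ) G (B s ω)

/-- The function `q` is a probability density of the random vector `Y` under `P`. -/
structure IsDensityOf {n : ℕ} {Ω : Type*} [MeasurableSpace Ω] (P : Measure Ω)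
    (Y : Ω → Euc n) (q : Euc n → ℝ) : Prop where
  measurable : Measurable q
  nonneg : ∀ x, 0 ≤ q x
  map_eq : P.map Y = volume.withDensity fun x => ENNReal.ofReal (q x)

/-- The covariance matrix of a random vector. -/
noncomputable def covMatrix {n : ℕ} {Ω : Type*} [MeasurableSpace Ω] (P : Measure Ω)
    (Y : Ω → Euc n) : Matrix (Fin n) (Fin n) ℝ :=
  Matrix.of fun i j => cov[fun ω => Y ω i, fun ω => Y ω j; P]

/-! ### The Fokker–Planck equation -/

/-- The probability flux `J[q] = b q - ε D ∇q`. -/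
noncomputable def probFlux {n : ℕ} (b : Euc n → Euc n) (D : Matrix (Fin n) (Fin n) ℝ) (ε : ℝ)
    (q : Euc n → ℝ) (x : Euc n) : Euc n :=
  q x • b x - ε • Matrix.toEuclideanCLM (𝕜 := ℝ) D (gradient q x)

/-- `u` is a classical solution of `∂ₛ u = -∇ · J[u]` on `ℝⁿ` for the times `s ∈ T`. -/
structure SolvesFokkerPlanck {n : ℕ} (b : Euc n → Euc n) (D : Matrix (Fin n) (Fin n) ℝ) (ε : ℝ)
    (u : Euc n → ℝ → ℝ) (T : Set ℝ) : Prop where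
  smooth : ∀ s ∈ T, ContDiff ℝ 2 fun x => u x s
  equation : ∀ s ∈ T, ∀ x,
    HasDerivAt (fun τ => u x τ) (-euclideanDiv (probFlux b D ε fun y => u y s) x) s

/-! ### The two asymptotic expansions -/

/-- The density on the scale of the central limit theorem, `ε^{n/2} q(x₀ + √ε z)`: if `q` is the
density of `X`, this is the density of `(X - x₀) / √ε`. -/
noncomputable def cltScaled {n : ℕ} (ε : ℝ) (x₀ : Euc n) (q : Euc n → ℝ) (z : Euc n) : ℝ :=
  ε ^ ((n : ℝ) / 2) * q (x₀ + √ε • z)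

/-- First two terms of the expansion in powers of `√ε` on the scale of the central limit theorem
about `x₀`: for each `z`, the rescaled density of `q ε` is `p₀ z + √ε p₁ z + o(√ε)` as `ε ↓ 0`. -/
def HasCLTExpansion {n : ℕ} (q : ℝ → Euc n → ℝ) (x₀ : Euc n) (p₀ p₁ : Euc n → ℝ) : Prop :=
  ∀ z, (fun ε : ℝ => cltScaled ε x₀ (q ε) z - (p₀ z + √ε * p₁ z)) =o[𝓝[>] 0] fun ε : ℝ => √ε

/-- WKB expansion `q ε = a(ε) exp(-φ/ε + ln ω + O(ε))` as `ε ↓ 0`, uniformly near `x₀`. -/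
def HasWKBExpansion {n : ℕ} (q : ℝ → Euc n → ℝ) (a : ℝ → ℝ) (φ ω : Euc n → ℝ)
    (x₀ : Euc n) : Prop :=
  ∃ δ > 0, ∃ C : ℝ, ∃ ε₁ > 0, ∀ ε ∈ Ioo 0 ε₁, ∀ x ∈ Metric.ball x₀ δ,
    ∃ r : ℝ, |r| ≤ C * ε ∧ q ε x = a ε * Real.exp (-(φ x / ε) + Real.log (ω x) + r)

/-!
The proof works at the fixed time `t` and studies the rescaled deviation
`Y_ε = (X_ε(t) - xhat(t)) / √ε`, whose density is the rescaled density `cltScaled`.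

*Probability.* The noise is additive, so `V = (X_ε - xhat) / √ε - Z` solves an ordinary differential
equation path by path. Its right-hand side is at most `η + L ‖V‖` as long as `‖V‖ ≤ 1`, with `η`
small because `b` is uniformly differentiable along the trajectory, and a Gronwall argument
propagates smallness from time `0` to time `t` (`exists_forall_norm_le_of_linearisation`). Along a
sequence on which the initial data converge almost surely, `Y_ε → Z(t)` almost surely
(`exists_seq_tendsto_ae_rescaled_deviation`).

*Analysis.* In the ratio of two values of the WKB form at distance `O(√ε)` the unknown amplitude
cancels (`HasWKBExpansion.exists_ratio`). Taylor's formula then bounds the rescaled densities on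
bounded sets (`HasWKBExpansion.exists_eventually_abs_cltScaled_le`), so their pointwise limit
`phat₀` is the density of `Z(t)`, as tests with compactly supported functions show
(`map_eq_withDensity_of_tendsto_cltScaled`). If `∇φ(xhat(t))` were nonzero this limit would vanish
identically, which is impossible for a probability density. Hence `∇φ(xhat(t)) = 0`, and comparing
coefficients gives `phat₀ = c exp(-Q/2)` and
`phat₁ = c₁ exp(-Q/2) + phat₀ (∇ln ω · z - φ‴(z, z, z) / 6)`, where `Q` is the quadratic form of the
Hessian (`HasWKBExpansion.clt_coefficients`).

*Gaussian integrals.* The total mass of `c exp(-Q/2)` is one, so the weight is integrable; this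
forces the Hessian to be positive definite (`Matrix.posDef_of_integrable_exp_quadForm`), and the
covariance of `Z(t)` is its inverse. In the first moment of `phat₁` the term `c₁ exp(-Q/2)` drops
out by symmetry, the linear term gives second moments, and the cubic term gives fourth moments,
which the substitution `z = S y` expresses through `Theta`
(`Matrix.PosDef.integral_coord_mul_correction`).
-/

/-! ### Linearisation along the deterministic trajectory -/

/-- A `C¹` map is differentiable uniformly on compact sets of base points and bounded sets of
directions. -/
theorem exists_forall_norm_differenceQuotient_sub_fderiv_le {E F : Type*} [NormedAddCommGroup E]
    [NormedSpace ℝ E] [NormedAddCommGroup F] [NormedSpace ℝ F] {b : E → F} (hb : ContDiff ℝ 1 b)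
    {K : Set E} (hK : IsCompact K) (R : ℝ) {η : ℝ} (hη : 0 < η) :
    ∃ δ > (0 : ℝ), ∀ h ∈ Ioo 0 δ, ∀ x ∈ K, ∀ v : E, ‖v‖ ≤ R →
      ‖h⁻¹ • (b (x + h • v) - b x) - fderiv ℝ b x v‖ ≤ η := by
  have hR : 0 < |R| + 1 := by positivity
  have hc : Continuous (fderiv ℝ b) := hb.continuous_fderiv (by simp)
  have h1 := hK.uniformContinuousAt_of_continuousAt (fderiv ℝ b) (fun a _ => hc.continuousAt)
    (Metric.dist_mem_uniformity (div_pos hη hR))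
  obtain ⟨δ, hδ, hδ'⟩ := Metric.mem_uniformity_dist.1 h1
  refine ⟨δ / (|R| + 1), by positivity, fun h hh x hx v hv => ?_⟩
  have hv' : ‖v‖ < |R| + 1 := by linarith [le_abs_self R]
  have hh0 : 0 < h := hh.1
  have hmem : ‖h • v‖ < δ := by
    rw [norm_smul, Real.norm_of_nonneg hh0.le]
    calc h * ‖v‖ ≤ h * (|R| + 1) := by gcongr
      _ < δ := (lt_div_iff₀ hR).1 hh.2
  have key := (convex_ball x δ).norm_image_sub_le_of_norm_fderiv_le' (𝕜 := ℝ) (f := b)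
    (C := η / (|R| + 1)) (x := x) (y := x + h • v) (φ := fderiv ℝ b x)
    (fun y _ => (hb.differentiable (by simp)) y)
    (fun y hy => by
      have := hδ' (a := x) (b := y) (by rwa [dist_comm]) hx
      simp only [mem_ofPred_eq] at this
      rw [← dist_eq_norm, dist_comm]
      exact this.le)
    (Metric.mem_ball_self hδ) (by simpa using hmem)
  have e : h⁻¹ • (b (x + h • v) - b x) - fderiv ℝ b x v
      = h⁻¹ • (b (x + h • v) - b x - fderiv ℝ b x (x + h • v - x)) := by
    rw [add_sub_cancel_left, map_smul, smul_sub h⁻¹ (_ - _), smul_smul,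
      inv_mul_cancel₀ hh0.ne', one_smul]
  rw [e, norm_smul, norm_inv, Real.norm_of_nonneg hh0.le]
  rw [add_sub_cancel_left, norm_smul, Real.norm_of_nonneg hh0.le] at key
  rw [add_sub_cancel_left]
  calc h⁻¹ * _ ≤ h⁻¹ * (η / (|R| + 1) * (h * ‖v‖)) := by gcongr
    _ = η * (‖v‖ / (|R| + 1)) := by field_simp
    _ ≤ η * 1 := by gcongr; exact (div_le_one hR).2 hv'.le
    _ = η := mul_one _

/-- Stability of the linearisation: if `xhat + h (z + V)` is driven by `b` up to a common forcing
term, so that `V` has the stated derivative, then `V t` is small as soon as `h` and `V 0` are.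
While `‖V‖ ≤ 1` the derivative of `V` is at most `η + L ‖V‖`, and the fencing theorem turns this
into an exponential bound that keeps `‖V‖ ≤ 1`. -/
theorem exists_forall_norm_le_of_linearisation {E : Type*} [NormedAddCommGroup E]
    [NormedSpace ℝ E] {b : E → E} (hb : ContDiff ℝ 1 b) {xhat z : ℝ → E} {t : ℝ} (ht : 0 ≤ t)
    (hx : ContinuousOn xhat (Icc 0 t)) (hz : ContinuousOn z (Icc 0 t)) {η : ℝ} (hη : 0 < η) :
    ∃ δ > (0 : ℝ), ∀ h ∈ Ioo 0 δ, ∀ V : ℝ → E, ContinuousOn V (Icc 0 t) →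
      (∀ s ∈ Ico 0 t, HasDerivWithinAt V
        (h⁻¹ • (b (xhat s + h • (z s + V s)) - b (xhat s)) - fderiv ℝ b (xhat s) (z s))
        (Ici s) s) →
      ‖V 0‖ ≤ δ → ‖V t‖ ≤ η := by
  have hK : IsCompact (xhat '' Icc 0 t) := isCompact_Icc.image_of_continuousOn hx
  obtain ⟨M, hM⟩ := isCompact_Icc.exists_bound_of_continuousOn hz
  have hc : Continuous (fderiv ℝ b) := hb.continuous_fderiv (by simp)
  obtain ⟨L, hL⟩ := hK.exists_bound_of_continuousOn hc.continuousOn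
  have hL0 : 0 ≤ L := (norm_nonneg _).trans (hL (xhat 0) ⟨0, ⟨le_rfl, ht⟩, rfl⟩)
  -- the bound `κ e^{(L+1)s}` stays below both `1` and `η` on `[0, t]`
  set κ := min 1 η * Real.exp (-((L + 1) * t)) with hκ
  have hκ0 : 0 < κ := by positivity
  obtain ⟨δ, hδ, hF⟩ := exists_forall_norm_differenceQuotient_sub_fderiv_le hb hK (M + 1)
    (half_pos hκ0)
  refine ⟨min δ κ, by positivity, fun h hh V hV hV' hV0 => ?_⟩
  have hBt : ∀ s ≤ t, κ * Real.exp ((L + 1) * s) ≤ min 1 η := by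
    intro s hs
    rw [hκ, mul_assoc, ← Real.exp_add]
    have : Real.exp (-((L + 1) * t) + (L + 1) * s) ≤ 1 := by
      rw [Real.exp_le_one_iff]; nlinarith
    exact mul_le_of_le_one_right (by positivity) this
  have := image_norm_le_of_norm_deriv_right_lt_deriv_boundary
    (B := fun s => κ * Real.exp ((L + 1) * s))
    (B' := fun s => κ * (Real.exp ((L + 1) * s) * (L + 1))) hV hV'
    (by simpa using hV0.trans (min_le_right _ _))
    (fun s => by simpa using (((hasDerivAt_id s).const_mul (L + 1)).exp).const_mul κ)
    (fun s hs hVs => by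
      have hs' : s ∈ Icc 0 t := Ico_subset_Icc_self hs
      have hb1 : ‖V s‖ ≤ 1 := hVs.trans_le ((hBt s hs.2.le).trans (min_le_left _ _))
      have hb2 := hF h ⟨hh.1, hh.2.trans_le (min_le_left _ _)⟩ _ (mem_image_of_mem _ hs')
        (z s + V s) ((norm_add_le _ _).trans (add_le_add (hM s hs') hb1))
      have hb3 : ‖fderiv ℝ b (xhat s) (V s)‖ ≤ L * ‖V s‖ :=
        (ContinuousLinearMap.le_opNorm _ _).trans
          (by gcongr; exact hL _ (mem_image_of_mem _ hs'))
      have hks : κ ≤ ‖V s‖ := by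
        rw [hVs]
        have := Real.one_le_exp (mul_nonneg (by positivity : 0 ≤ L + 1) hs.1)
        nlinarith
      calc _ = ‖(h⁻¹ • (b (xhat s + h • (z s + V s)) - b (xhat s))
              - fderiv ℝ b (xhat s) (z s + V s)) + fderiv ℝ b (xhat s) (V s)‖ := by
            rw [map_add]; congr 1; abel
        _ ≤ κ / 2 + L * ‖V s‖ := (norm_add_le _ _).trans (add_le_add hb2 hb3)
        _ < ‖V s‖ * (L + 1) := by nlinarith
        _ = _ := by rw [hVs]; ring)
    (right_mem_Icc.2 ht)
  exact this.trans ((hBt t le_rfl).trans (min_le_right _ _))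

/-- The indefinite integral of a function continuous on `[0, ∞)` has the expected right
derivative. -/
theorem hasDerivWithinAt_integral_Ici {E : Type*} [NormedAddCommGroup E] [NormedSpace ℝ E]
    [CompleteSpace E] {g : ℝ → E} (hg : ContinuousOn g (Ici 0)) {s : ℝ} (hs : 0 ≤ s) :
    HasDerivWithinAt (fun u => ∫ r in (0 : ℝ)..u, g r) (g s) (Ici s) s := by
  have hg' : Continuous fun r => g (max r 0) :=
    hg.comp_continuous (by fun_prop) fun r => le_max_right r 0
  have h := (hg'.integral_hasStrictDerivAt 0 s).hasDerivAt.hasDerivWithinAt (s := Ici s)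
  simp only [max_eq_left hs] at h
  have e : ∀ u ∈ Ici s, ∫ r in (0 : ℝ)..u, g r = ∫ r in (0 : ℝ)..u, g (max r 0) := by
    intro u hu
    refine intervalIntegral.integral_congr fun r hr => ?_
    rw [uIcc_of_le (hs.trans hu)] at hr
    simp only [max_eq_left hr.1]
  exact h.congr e (e s self_mem_Ici)

/-- Pathwise central limit scaling: along any sequence `h k → 0+`, if the paths `x k` solve
`x' = b(x)` forced by `h k • w`, the path `z` solves the linearisation along `xhat` forced by `w`,
and the rescaled initial deviations converge to `z 0`, then the rescaled deviations at time `t`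
converge to `z t`. -/
theorem tendsto_rescaled_deviation {E : Type*} [NormedAddCommGroup E] [NormedSpace ℝ E]
    [CompleteSpace E] {b : E → E} (hb : ContDiff ℝ 1 b) {xhat z : ℝ → E} {w : ℝ → E}
    (hxhat : ∀ s, 0 ≤ s → HasDerivWithinAt xhat (b (xhat s)) (Ici 0) s)
    (hz : ContinuousOn z (Ici 0))
    (hz' : ∀ s, 0 ≤ s → z s = z 0 + (∫ r in (0 : ℝ)..s, fderiv ℝ b (xhat r) (z r)) + w s)
    {h : ℕ → ℝ} (hh : Tendsto h atTop (𝓝[>] 0)) {x : ℕ → ℝ → E}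
    (hx : ∀ k, ContinuousOn (x k) (Ici 0))
    (hx' : ∀ k s, 0 ≤ s → x k s = x k 0 + (∫ r in (0 : ℝ)..s, b (x k r)) + h k • w s)
    (h0 : Tendsto (fun k => (h k)⁻¹ • (x k 0 - xhat 0)) atTop (𝓝 (z 0)))
    {t : ℝ} (ht : 0 ≤ t) :
    Tendsto (fun k => (h k)⁻¹ • (x k t - xhat t)) atTop (𝓝 (z t)) := by
  have hxc : ContinuousOn xhat (Ici 0) := fun s hs => (hxhat s hs).continuousWithinAt
  rw [Metric.tendsto_nhds]
  intro η hη
  obtain ⟨δ, hδ, H⟩ := exists_forall_norm_le_of_linearisation hb ht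
    (hxc.mono Icc_subset_Ici_self) (hz.mono Icc_subset_Ici_self) (half_pos hη)
  filter_upwards [hh (Ioo_mem_nhdsGT hδ), Metric.tendsto_nhds.1 h0 δ hδ] with k hk hk0
  have hkne : h k ≠ 0 := hk.1.ne'
  rw [dist_eq_norm] at hk0 ⊢
  refine (H (h k) hk (fun s => (h k)⁻¹ • (x k s - xhat s) - z s) ?_ ?_ hk0.le).trans_lt
    (half_lt_self hη)
  · exact ((((hx k).sub hxc).const_smul _).sub hz).mono Icc_subset_Ici_self
  · intro s hs
    have hI1 := hasDerivWithinAt_integral_Ici (g := fun r => b (x k r))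
      (hb.continuous.comp_continuousOn (hx k)) hs.1
    have hI2 := hasDerivWithinAt_integral_Ici (g := fun r => fderiv ℝ b (xhat r) (z r))
      (((hb.continuous_fderiv (by simp)).comp_continuousOn hxc).clm_apply hz) hs.1
    have hd := (((hI1.sub ((hxhat s hs.1).mono (Ici_subset_Ici.2 hs.1))).const_smul
      (h k)⁻¹).sub hI2).const_add ((h k)⁻¹ • x k 0 - z 0)
    refine HasDerivWithinAt.congr_of_mem (f := fun u => (h k)⁻¹ • x k 0 - z 0 +
      ((h k)⁻¹ • ((∫ r in (0 : ℝ)..u, b (x k r)) - xhat u)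
        - ∫ r in (0 : ℝ)..u, fderiv ℝ b (xhat r) (z r))) ?_ ?_ self_mem_Ici
    · have e : xhat s + h k • (z s + ((h k)⁻¹ • (x k s - xhat s) - z s)) = x k s := by
        rw [add_sub_cancel, smul_inv_smul₀ hkne, add_sub_cancel]
      rw [e]
      exact hd
    · intro u hu
      have hu0 : 0 ≤ u := hs.1.trans hu
      simp only [hx' k u hu0]
      rw [hz' u hu0]
      simp only [smul_sub, smul_add, smul_smul, inv_mul_cancel₀ hkne, one_smul]
      abel

/-- Along some sequence `ε k → 0+` the rescaled deviations of the diffusions from the deterministic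
trajectory converge almost surely to the solution of the linearised equation, at every time. -/
theorem exists_seq_tendsto_ae_rescaled_deviation {n : ℕ} {Ω : Type*} [MeasurableSpace Ω]
    {P : Measure Ω} [IsProbabilityMeasure P] {b : Euc n → Euc n} (hb : ContDiff ℝ 1 b)
    {G : Matrix (Fin n) (Fin n) ℝ} {B : ℝ≥0 → Ω → Euc n} {ε₀ : ℝ} (hε₀ : 0 < ε₀)
    {X : ℝ → ℝ → Ω → Euc n}
    (hX : ∀ ε ∈ Ioo 0 ε₀, IsSDESolution P B (fun _ x => b x) (√ε • G) (X ε))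
    {xhat : ℝ → Euc n} (hxhat : ∀ s, 0 ≤ s → HasDerivWithinAt xhat (b (xhat s)) (Ici 0) s)
    {Z : ℝ → Ω → Euc n} (hZ : IsSDESolution P B (fun s z => fderiv ℝ b (xhat s) z) G Z)
    (hZ₀ : TendstoInMeasure P (fun (ε : ℝ) ω => (√ε)⁻¹ • (X ε 0 ω - xhat 0)) (𝓝[>] 0) (Z 0)) :
    ∃ ε : ℕ → ℝ, Tendsto ε atTop (𝓝[>] 0) ∧ (∀ k, ε k ∈ Ioo 0 ε₀) ∧ ∀ t, 0 ≤ t →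
      ∀ᵐ ω ∂P, Tendsto (fun k => (√(ε k))⁻¹ • (X (ε k) t ω - xhat t)) atTop (𝓝 (Z t ω)) := by
  obtain ⟨ε', hε', hlim⟩ := hZ₀.exists_seq_tendsto_ae'
  obtain ⟨N, hN⟩ := eventually_atTop.1 (hε' (Ioo_mem_nhdsGT hε₀))
  have hε : Tendsto (fun k => ε' (k + N)) atTop (𝓝[>] 0) := hε'.comp (tendsto_add_atTop_nat N)
  have hmem : ∀ k, ε' (k + N) ∈ Ioo 0 ε₀ := fun k => hN _ (Nat.le_add_left _ _)
  refine ⟨fun k => ε' (k + N), hε, hmem, fun t ht => ?_⟩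
  have hsq : Tendsto (fun k => √(ε' (k + N))) atTop (𝓝[>] 0) := by
    refine tendsto_nhdsWithin_iff.2 ⟨?_, Eventually.of_forall fun k => Real.sqrt_pos.2 (hmem k).1⟩
    simpa using (hε.mono_right nhdsWithin_le_nhds).sqrt
  filter_upwards [hlim, hZ.continuous_paths, hZ.equation,
    ae_all_iff.2 fun k => (hX _ (hmem k)).continuous_paths,
    ae_all_iff.2 fun k => (hX _ (hmem k)).equation] with ω h0 hZc hZe hXc hXe
  refine tendsto_rescaled_deviation (xhat := xhat) (z := fun s => Z s ω)
    (w := fun s => Matrix.toEuclideanCLM (𝕜 := ℝ) G (B s.toNNReal ω)) hb hxhat hZc ?_ hsq hXc ?_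
    (h0.comp (tendsto_add_atTop_nat N)) ht
  · intro s hs
    simpa [Real.coe_toNNReal s hs] using hZe s.toNNReal
  · intro k s hs
    simpa [Real.coe_toNNReal s hs] using hXe k s.toNNReal

/-! ### Taylor's formula of third order -/

/-- Taylor's formula of order three at a point, with remainder in Peano's form. -/
theorem ContDiffAt.taylor_three_isLittleO {E : Type*} [NormedAddCommGroup E] [NormedSpace ℝ E]
    {f : E → ℝ} {x : E} (hf : ContDiffAt ℝ 3 f x) :
    (fun h => f (x + h) - (f x + fderiv ℝ f x h + iteratedFDeriv ℝ 2 f x (fun _ => h) / 2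
      + iteratedFDeriv ℝ 3 f x (fun _ => h) / 6)) =o[𝓝 0] fun h => ‖h‖ ^ 3 := by
  refine Asymptotics.isLittleO_iff.2 fun η hη => ?_
  have h3 : ContinuousAt (iteratedFDeriv ℝ 3 f) x :=
    (hf.iteratedFDeriv_right (i := 3) (m := 0) (by norm_num)).continuousAt
  have hev := (hf.eventually (by simp)).and (Metric.tendsto_nhds.1 h3.tendsto η hη)
  obtain ⟨δ, hδ, hball⟩ := Metric.eventually_nhds_iff.1 hev
  filter_upwards [Metric.ball_mem_nhds (0 : E) hδ] with h hh
  have hseg : ∀ t ∈ Icc (0 : ℝ) 1, Dist.dist (x + t • h) x < δ := by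
    intro t ht
    rw [dist_self_add_left, norm_smul, Real.norm_of_nonneg ht.1]
    rw [mem_ball_zero_iff] at hh
    nlinarith [ht.2, norm_nonneg h]
  have hT := map_add_eq_sum_add_integral_iteratedFDeriv (f := f) (x := x) (y := h) (n := 2)
    (fun t ht => by norm_num; exact (hball (hseg t ht)).1)
  have hcont : ContinuousOn (fun t : ℝ => (1 - t) ^ 2 • iteratedFDeriv ℝ 3 f (x + t • h)
      (fun _ => h)) (uIcc 0 1) := by
    intro t ht
    rw [uIcc_of_le zero_le_one] at ht
    have h1 : ContinuousAt (iteratedFDeriv ℝ 3 f) (x + t • h) :=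
      ((hball (hseg t ht)).1.iteratedFDeriv_right (i := 3) (m := 0) (by norm_num)).continuousAt
    have h2 : ContinuousAt (fun t : ℝ => iteratedFDeriv ℝ 3 f (x + t • h)) t :=
      h1.comp (f := fun t : ℝ => x + t • h) (by fun_prop)
    exact (((by fun_prop : Continuous fun t : ℝ => (1 - t) ^ 2).continuousAt).smul
      (h2.eval_const _)).continuousWithinAt
  have hconst : ∫ t in (0 : ℝ)..1, (1 - t) ^ 2 • iteratedFDeriv ℝ 3 f x (fun _ => h)
      = iteratedFDeriv ℝ 3 f x (fun _ => h) / 3 := by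
    rw [intervalIntegral.integral_smul_const]
    rw [intervalIntegral.integral_comp_sub_left (fun t : ℝ => t ^ 2) 1]
    simp only [smul_eq_mul, integral_pow]
    norm_num
    ring
  have hsub := intervalIntegral.integral_sub (μ := volume) hcont.intervalIntegrable
    ((by fun_prop : Continuous fun t : ℝ => (1 - t) ^ 2 •
      iteratedFDeriv ℝ 3 f x (fun _ => h)).intervalIntegrable 0 1)
  rw [hconst] at hsub
  have hbound := intervalIntegral.norm_integral_le_of_norm_le_const (a := 0) (b := 1)
    (f := fun t : ℝ => (1 - t) ^ 2 • iteratedFDeriv ℝ 3 f (x + t • h) (fun _ => h) -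
      (1 - t) ^ 2 • iteratedFDeriv ℝ 3 f x (fun _ => h)) (C := η * ‖h‖ ^ 3) (by
    intro t ht
    rw [uIoc_of_le zero_le_one] at ht
    have h1 := (hball (hseg t ⟨ht.1.le, ht.2⟩)).2
    rw [dist_eq_norm] at h1
    rw [← smul_sub, norm_smul, ← _root_.sub_apply]
    have h2 := (iteratedFDeriv ℝ 3 f (x + t • h) - iteratedFDeriv ℝ 3 f x).le_opNorm (fun _ => h)
    simp only [Finset.prod_const, Finset.card_univ, Fintype.card_fin] at h2
    have h3 : ‖(1 - t) ^ 2‖ ≤ 1 := by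
      rw [norm_pow, Real.norm_of_nonneg (by linarith [ht.2])]
      exact pow_le_one₀ (by linarith [ht.2]) (by linarith [ht.1])
    calc _ ≤ 1 * (η * ‖h‖ ^ 3) := by
          gcongr
          exact h2.trans (by gcongr)
      _ = _ := one_mul _)
  rw [hsub] at hbound
  norm_num [Finset.sum_range_succ, Nat.factorial] at hT hbound
  rw [norm_pow, norm_norm, hT]
  norm_num [Real.norm_eq_abs] at hbound ⊢
  calc _ = |(∫ t in (0 : ℝ)..1, (1 - t) ^ 2 * iteratedFDeriv ℝ 3 f (x + t • h) fun _ => h) -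
        iteratedFDeriv ℝ 3 f x (fun _ => h) / 3| / 2 := by
        rw [← abs_two, ← abs_div, abs_two]; congr 1; ring
    _ ≤ η * ‖h‖ ^ 3 / 2 := by gcongr
    _ ≤ η * ‖h‖ ^ 3 := by
        have : 0 ≤ η * ‖h‖ ^ 3 := by positivity
        linarith

/-- The remainder of the Taylor polynomial of first order is at most quadratic. -/
theorem ContDiffAt.exists_abs_sub_fderiv_le {E : Type*} [NormedAddCommGroup E] [NormedSpace ℝ E]
    {f : E → ℝ} {x : E} (hf : ContDiffAt ℝ 3 f x) :
    ∃ C, ∀ᶠ h in 𝓝 (0 : E), |f (x + h) - f x - fderiv ℝ f x h| ≤ C * ‖h‖ ^ 2 := by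
  refine ⟨‖iteratedFDeriv ℝ 2 f x‖ + ‖iteratedFDeriv ℝ 3 f x‖ + 1, ?_⟩
  filter_upwards [Asymptotics.isLittleO_iff.1 hf.taylor_three_isLittleO one_pos,
    Metric.ball_mem_nhds (0 : E) one_pos] with h h1 h2
  rw [mem_ball_zero_iff] at h2
  have h3 := (iteratedFDeriv ℝ 2 f x).le_opNorm (fun _ => h)
  have h4 := (iteratedFDeriv ℝ 3 f x).le_opNorm (fun _ => h)
  simp only [Finset.prod_const, Finset.card_univ, Fintype.card_fin] at h3 h4
  rw [norm_pow, norm_norm, one_mul] at h1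
  have h5 : ‖h‖ ^ 3 ≤ ‖h‖ ^ 2 := pow_le_pow_of_le_one (norm_nonneg _) h2.le (by norm_num)
  have h6 : ‖iteratedFDeriv ℝ 3 f x‖ * ‖h‖ ^ 3 ≤ ‖iteratedFDeriv ℝ 3 f x‖ * ‖h‖ ^ 2 := by gcongr
  rw [Real.norm_eq_abs] at h1 h3 h4
  have h7 := abs_le.1 h1
  have h8 := abs_le.1 h3
  have h9 := abs_le.1 h4
  have h10 : 0 ≤ ‖iteratedFDeriv ℝ 2 f x‖ * ‖h‖ ^ 2 := by positivity
  have h11 : 0 ≤ ‖iteratedFDeriv ℝ 3 f x‖ * ‖h‖ ^ 2 := by positivity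
  rw [abs_le]
  constructor <;> linarith

theorem tendsto_sqrt_smul_nhdsGT {E : Type*} [NormedAddCommGroup E] [NormedSpace ℝ E] (z : E) :
    Tendsto (fun ε : ℝ => √ε • z) (𝓝[>] 0) (𝓝 0) := by
  have : Tendsto (fun ε : ℝ => √ε • z) (𝓝 0) (𝓝 (√0 • z)) :=
    (by fun_prop : Continuous fun ε : ℝ => √ε • z).tendsto 0
  simpa using this.mono_left nhdsWithin_le_nhds

/-- Third-order expansion of the rescaled increment `(f(x + √ε z) - f(x)) / ε`. -/
theorem ContDiffAt.rescaled_increment_isLittleO {E : Type*} [NormedAddCommGroup E]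
    [NormedSpace ℝ E] {f : E → ℝ} {x : E} (hf : ContDiffAt ℝ 3 f x) (z : E) :
    (fun ε : ℝ => (f (x + √ε • z) - f x) / ε - (fderiv ℝ f x z / √ε
      + iteratedFDeriv ℝ 2 f x (fun _ => z) / 2
      + √ε * (iteratedFDeriv ℝ 3 f x (fun _ => z) / 6))) =o[𝓝[>] 0] fun ε : ℝ => √ε := by
  have h1 := hf.taylor_three_isLittleO.comp_tendsto (tendsto_sqrt_smul_nhdsGT z)
  have h2 : (fun ε : ℝ => ‖√ε • z‖ ^ 3) =O[𝓝[>] 0] fun ε : ℝ => √ε ^ 3 := by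
    refine Asymptotics.IsBigO.of_bound (‖z‖ ^ 3) (Eventually.of_forall fun ε => ?_)
    simp [norm_smul, mul_pow, mul_comm]
  have h3 := (h1.trans_isBigO h2).mul_isBigO
    (Asymptotics.isBigO_refl (fun ε : ℝ => (√ε ^ 2)⁻¹) (𝓝[>] 0))
  refine h3.congr' ?_ ?_ <;> filter_upwards [self_mem_nhdsWithin] with ε hε
  · have hs : 0 < √ε := Real.sqrt_pos.2 hε
    have he : ε = √ε ^ 2 := (Real.sq_sqrt (le_of_lt hε)).symm
    have e2 : iteratedFDeriv ℝ 2 f x (fun _ => √ε • z)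
        = √ε ^ 2 * iteratedFDeriv ℝ 2 f x (fun _ => z) := by
      simpa using (iteratedFDeriv ℝ 2 f x).map_smul_univ (fun _ => √ε) (fun _ => z)
    have e3 : iteratedFDeriv ℝ 3 f x (fun _ => √ε • z)
        = √ε ^ 3 * iteratedFDeriv ℝ 3 f x (fun _ => z) := by
      simpa using (iteratedFDeriv ℝ 3 f x).map_smul_univ (fun _ => √ε) (fun _ => z)
    simp only [Function.comp_apply, e2, e3, map_smul, smul_eq_mul]
    generalize f (x + √ε • z) = y
    generalize √ε = s at *
    subst he
    field_simp
    ring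
  · have hs : 0 < √ε := Real.sqrt_pos.2 hε
    field_simp

/-! ### Comparison of the two expansions of the density -/

section WKB

variable {n : ℕ} {q : ℝ → Euc n → ℝ} {x₀ : Euc n} {p₀ p₁ : Euc n → ℝ} {a : ℝ → ℝ}
  {φ ω : Euc n → ℝ}

/-- The amplitude `a(ε)` cancels in the ratio of the values of the density at two points at
distance `O(√ε)` from `x₀`. -/
theorem HasWKBExpansion.exists_ratio (h : HasWKBExpansion q a φ ω x₀) (R : ℝ) :
    ∃ C, ∀ᶠ ε in 𝓝[>] (0 : ℝ), ∀ z z' : Euc n, ‖z‖ ≤ R → ‖z'‖ ≤ R → ∃ r : ℝ, |r| ≤ C * ε ∧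
      cltScaled ε x₀ (q ε) z = cltScaled ε x₀ (q ε) z' *
        Real.exp (-((φ (x₀ + √ε • z) - φ x₀) / ε - (φ (x₀ + √ε • z') - φ x₀) / ε)
          + (Real.log (ω (x₀ + √ε • z)) - Real.log (ω (x₀ + √ε • z'))) + r) := by
  obtain ⟨δ, hδ, C, ε₁, hε₁, H⟩ := h
  refine ⟨2 * C, ?_⟩
  have h1 : Tendsto (fun ε : ℝ => √ε * R) (𝓝[>] 0) (𝓝 0) := tendsto_sqrt_smul_nhdsGT R
  filter_upwards [Ioo_mem_nhdsGT hε₁, h1.eventually_lt_const hδ] with ε hε hR z z' hz hz'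
  have hmem : ∀ y : Euc n, ‖y‖ ≤ R → x₀ + √ε • y ∈ Metric.ball x₀ δ := by
    intro y hy
    rw [mem_ball_iff_norm, add_sub_cancel_left, norm_smul, Real.norm_of_nonneg (by positivity)]
    exact (by gcongr : √ε * ‖y‖ ≤ √ε * R).trans_lt hR
  obtain ⟨r, hr, hq⟩ := H ε hε _ (hmem z hz)
  obtain ⟨r', hr', hq'⟩ := H ε hε _ (hmem z' hz')
  refine ⟨r - r', (abs_sub _ _).trans (by linarith), ?_⟩
  simp only [cltScaled, hq, hq']
  rw [mul_assoc, mul_assoc, ← Real.exp_add]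
  congr 3
  ring

theorem tendsto_log_comp_sqrt_smul (hω : ContDiffAt ℝ 1 ω x₀) (hpos : 0 < ω x₀) (z : Euc n) :
    Tendsto (fun ε : ℝ => Real.log (ω (x₀ + √ε • z))) (𝓝[>] 0) (𝓝 (Real.log (ω x₀))) := by
  have h1 : ContinuousAt (fun y => Real.log (ω y)) x₀ :=
    hω.continuousAt.log hpos.ne'
  refine h1.tendsto.comp ?_
  simpa using (tendsto_sqrt_smul_nhdsGT z).const_add x₀

/-- The rescaled densities are bounded, uniformly on bounded sets. Values on a ball are compared
with the value at a point of the ball where the linear form `∇φ(x₀)` is smallest. -/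
theorem HasWKBExpansion.exists_eventually_abs_cltScaled_le (h : HasWKBExpansion q a φ ω x₀)
    (hq : ∀ z, Tendsto (fun ε => cltScaled ε x₀ (q ε) z) (𝓝[>] 0) (𝓝 (p₀ z)))
    (hφ : ContDiffAt ℝ 3 φ x₀) (hω : ContDiffAt ℝ 1 ω x₀) (hpos : 0 < ω x₀) (R : ℝ)
    (hR : 0 ≤ R) :
    ∃ K, ∀ᶠ ε in 𝓝[>] (0 : ℝ), ∀ z, ‖z‖ ≤ R → |cltScaled ε x₀ (q ε) z| ≤ K := by
  obtain ⟨z', hz', hmin⟩ := (isCompact_closedBall (0 : Euc n) R).exists_isMinOn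
    ⟨0, by simpa using hR⟩ (fderiv ℝ φ x₀).continuous.continuousOn
  rw [mem_closedBall_zero_iff] at hz'
  obtain ⟨C, hC⟩ := h.exists_ratio R
  obtain ⟨C₂, hC₂⟩ := hφ.exists_abs_sub_fderiv_le
  have hlog : ContinuousAt (fun y => Real.log (ω y)) x₀ := hω.continuousAt.log hpos.ne'
  have hlog' : ∀ᶠ y in 𝓝 (0 : Euc n), |Real.log (ω (x₀ + y)) - Real.log (ω x₀)| < 1 := by
    have : Tendsto (fun y => x₀ + y) (𝓝 0) (𝓝 x₀) := by
      simpa using (continuous_const_add x₀).tendsto (0 : Euc n)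
    exact Metric.tendsto_nhds.1 (hlog.tendsto.comp this) 1 one_pos
  obtain ⟨δ, hδ, hb⟩ := Metric.eventually_nhds_iff.1 (hC₂.and hlog')
  have h1 : Tendsto (fun ε : ℝ => √ε * R) (𝓝[>] 0) (𝓝 0) := tendsto_sqrt_smul_nhdsGT R
  refine ⟨(|p₀ z'| + 1) * Real.exp (2 * |C₂| * R ^ 2 + 2 + |C|), ?_⟩
  filter_upwards [hC, h1.eventually_lt_const hδ, Ioo_mem_nhdsGT one_pos,
    (hq z').abs.eventually_lt_const (lt_add_one |p₀ z'|)] with ε hCε hRε hε hq' z hz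
  obtain ⟨r, hr, e⟩ := hCε z z' hz hz'
  have hs : 0 < √ε := Real.sqrt_pos.2 hε.1
  have hbd : ∀ y : Euc n, ‖y‖ ≤ R →
      |(φ (x₀ + √ε • y) - φ x₀) / ε - fderiv ℝ φ x₀ y / √ε| ≤ |C₂| * R ^ 2 ∧
      |Real.log (ω (x₀ + √ε • y)) - Real.log (ω x₀)| < 1 := by
    intro y hy
    have hy1 : ‖√ε • y‖ = √ε * ‖y‖ := by rw [norm_smul, Real.norm_of_nonneg hs.le]
    have hb' := hb (y := √ε • y) (by
      rw [dist_zero_right, hy1]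
      exact (by gcongr : √ε * ‖y‖ ≤ √ε * R).trans_lt hRε)
    refine ⟨?_, hb'.2⟩
    have h3 := hb'.1
    rw [map_smul, smul_eq_mul, hy1, mul_pow, Real.sq_sqrt hε.1.le] at h3
    have e4 : (φ (x₀ + √ε • y) - φ x₀) / ε - fderiv ℝ φ x₀ y / √ε
        = (φ (x₀ + √ε • y) - φ x₀ - √ε * fderiv ℝ φ x₀ y) / ε := by
      have : √ε * √ε = ε := Real.mul_self_sqrt hε.1.le
      rw [sub_div (φ (x₀ + √ε • y) - φ x₀)]
      congr 1
      rw [div_eq_div_iff hs.ne' hε.1.ne']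
      linear_combination (-(fderiv ℝ φ x₀ y)) * this
    rw [e4, abs_div, abs_of_pos hε.1, div_le_iff₀ hε.1]
    calc _ ≤ C₂ * (ε * ‖y‖ ^ 2) := h3
      _ ≤ |C₂| * (ε * ‖y‖ ^ 2) := by
        have := le_abs_self C₂
        have := hε.1
        gcongr
      _ ≤ |C₂| * (ε * R ^ 2) := by
        have := hε.1
        gcongr
      _ = _ := by ring
  rw [e, abs_mul, Real.abs_exp]
  have hzb := hbd z hz
  have hzb' := hbd z' hz'
  have hA : fderiv ℝ φ x₀ z' / √ε ≤ fderiv ℝ φ x₀ z / √ε := by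
    gcongr
    exact hmin (by simpa using hz)
  have hr2 : r ≤ |C| := by
    have h5 : C * ε ≤ |C| * 1 := mul_le_mul (le_abs_self C) hε.2.le hε.1.le (abs_nonneg _)
    linarith [le_abs_self r]
  have := abs_le.1 hzb.1
  have := abs_le.1 hzb'.1
  have := abs_lt.1 hzb.2
  have := abs_lt.1 hzb'.2
  exact mul_le_mul hq'.le (Real.exp_le_exp.2 (by linarith)) (Real.exp_pos _).le (by positivity)

/-- If `∇φ(x₀) ≠ 0`, the rescaled densities tend to zero. -/
theorem HasWKBExpansion.eq_zero_of_fderiv_ne_zero (h : HasWKBExpansion q a φ ω x₀)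
    (hq : ∀ z, Tendsto (fun ε => cltScaled ε x₀ (q ε) z) (𝓝[>] 0) (𝓝 (p₀ z)))
    (hφ : ContDiffAt ℝ 3 φ x₀) (hω : ContDiffAt ℝ 1 ω x₀) (hpos : 0 < ω x₀)
    (hne : fderiv ℝ φ x₀ ≠ 0) (z : Euc n) : p₀ z = 0 := by
  obtain ⟨v, hv⟩ : ∃ v, 0 < fderiv ℝ φ x₀ v := by
    obtain ⟨v, hv⟩ : ∃ v, fderiv ℝ φ x₀ v ≠ 0 := by
      by_contra! hcon
      exact hne (ContinuousLinearMap.ext hcon)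
    rcases hv.lt_or_gt with hv | hv
    · exact ⟨-v, by simpa using hv⟩
    · exact ⟨v, hv⟩
  obtain ⟨C, hC⟩ := h.exists_ratio (‖z‖ + ‖v‖)
  have hsq0 : Tendsto (fun ε : ℝ => √ε) (𝓝[>] 0) (𝓝 0) := by
    simpa using tendsto_sqrt_smul_nhdsGT (1 : ℝ)
  have hbdd : ∀ y : Euc n, Tendsto (fun ε : ℝ => (φ (x₀ + √ε • y) - φ x₀) / ε
      - fderiv ℝ φ x₀ y / √ε) (𝓝[>] 0) (𝓝 (iteratedFDeriv ℝ 2 φ x₀ (fun _ => y) / 2)) := by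
    intro y
    have h1 := (hφ.rescaled_increment_isLittleO y).trans_tendsto hsq0
    have h2 := (h1.add_const (iteratedFDeriv ℝ 2 φ x₀ (fun _ => y) / 2)).add
      (hsq0.mul_const (iteratedFDeriv ℝ 3 φ x₀ (fun _ => y) / 6))
    simp only [zero_add, zero_mul, add_zero] at h2
    refine h2.congr fun ε => ?_
    ring
  have hinv : Tendsto (fun ε : ℝ => fderiv ℝ φ x₀ v / √ε) (𝓝[>] 0) atTop := by
    refine Tendsto.const_mul_atTop hv (tendsto_inv_nhdsGT_zero.comp ?_)
    exact tendsto_nhdsWithin_iff.2 ⟨hsq0, by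
      filter_upwards [self_mem_nhdsWithin] with ε hε using Real.sqrt_pos.2 hε⟩
  -- the exponent in the ratio of the values at `z` and at `z - v`, up to its bounded remainder
  have hexp : Tendsto (fun ε : ℝ => -((φ (x₀ + √ε • z) - φ x₀) / ε
        - (φ (x₀ + √ε • (z - v)) - φ x₀) / ε)
      + (Real.log (ω (x₀ + √ε • z)) - Real.log (ω (x₀ + √ε • (z - v)))) + |C|)
      (𝓝[>] 0) atBot := by
    have h1 := ((((hbdd (z - v)).sub (hbdd z)).add
      ((tendsto_log_comp_sqrt_smul hω hpos z).sub
        (tendsto_log_comp_sqrt_smul hω hpos (z - v)))).add_const |C|).add_atBot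
        (tendsto_neg_atTop_atBot.comp hinv)
    refine h1.congr fun ε => ?_
    simp only [Function.comp_apply, map_sub]
    ring
  have hlim := ((hq (z - v)).abs).mul (Real.tendsto_exp_atBot.comp hexp)
  rw [mul_zero] at hlim
  refine tendsto_nhds_unique (hq z) (squeeze_zero_norm' ?_ hlim)
  filter_upwards [hC, Ioo_mem_nhdsGT one_pos] with ε hCε hε
  obtain ⟨r, hr, e⟩ := hCε z (z - v) (by linarith [norm_nonneg v]) (norm_sub_le _ _)
  rw [e, norm_mul, Real.norm_eq_abs, Real.norm_eq_abs, Real.abs_exp]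
  simp only [Function.comp_apply]
  have hr2 : r ≤ |C| := by
    have h5 : C * ε ≤ |C| * 1 := mul_le_mul (le_abs_self C) hε.2.le hε.1.le (abs_nonneg _)
    linarith [le_abs_self r]
  gcongr

theorem HasCLTExpansion.tendsto_quotient (h : HasCLTExpansion q x₀ p₀ p₁) (z : Euc n) :
    Tendsto (fun ε : ℝ => (cltScaled ε x₀ (q ε) z - p₀ z) / √ε) (𝓝[>] 0) (𝓝 (p₁ z)) := by
  have h1 := (h z).tendsto_div_nhds_zero.add_const (p₁ z)
  rw [zero_add] at h1
  refine h1.congr' ?_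
  filter_upwards [self_mem_nhdsWithin] with ε hε
  have hs : 0 < √ε := Real.sqrt_pos.2 hε
  field_simp
  ring

theorem HasCLTExpansion.tendsto_cltScaled (h : HasCLTExpansion q x₀ p₀ p₁) (z : Euc n) :
    Tendsto (fun ε : ℝ => cltScaled ε x₀ (q ε) z) (𝓝[>] 0) (𝓝 (p₀ z)) := by
  have hsq0 : Tendsto (fun ε : ℝ => √ε) (𝓝[>] 0) (𝓝 0) := by
    simpa using tendsto_sqrt_smul_nhdsGT (1 : ℝ)
  have h1 := ((h.tendsto_quotient z).mul hsq0).add_const (p₀ z)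
  rw [mul_zero, zero_add] at h1
  refine h1.congr' ?_
  filter_upwards [self_mem_nhdsWithin] with ε hε
  have hs : 0 < √ε := Real.sqrt_pos.2 hε
  field_simp
  ring

/-- The exponent of the ratio of the densities at `x₀ + √ε z` and `x₀`, when `∇φ(x₀) = 0`. -/
theorem HasWKBExpansion.exists_eventually_eq_mul_exp (h : HasWKBExpansion q a φ ω x₀)
    (hφ : ContDiffAt ℝ 3 φ x₀) (hω : ContDiffAt ℝ 1 ω x₀) (hpos : 0 < ω x₀)
    (h0 : fderiv ℝ φ x₀ = 0) (z : Euc n) :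
    ∃ e : ℝ → ℝ, Tendsto (fun ε => e ε / √ε) (𝓝[>] 0)
        (𝓝 (fderiv ℝ (fun x => Real.log (ω x)) x₀ z - iteratedFDeriv ℝ 3 φ x₀ (fun _ => z) / 6)) ∧
      ∀ᶠ ε in 𝓝[>] (0 : ℝ), cltScaled ε x₀ (q ε) z = cltScaled ε x₀ (q ε) 0 *
        Real.exp (-(iteratedFDeriv ℝ 2 φ x₀ (fun _ => z) / 2) + e ε) := by
  obtain ⟨C, hC⟩ := h.exists_ratio ‖z‖
  obtain ⟨r, hr⟩ := (hC.mono fun ε hε => hε z 0 le_rfl (by simp)).choice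
  refine ⟨fun ε => -((φ (x₀ + √ε • z) - φ x₀) / ε) + (Real.log (ω (x₀ + √ε • z))
    - Real.log (ω x₀)) + r ε + iteratedFDeriv ℝ 2 φ x₀ (fun _ => z) / 2, ?_, ?_⟩
  · have hsq0 : Tendsto (fun ε : ℝ => √ε) (𝓝[>] 0) (𝓝 0) := by
      simpa using tendsto_sqrt_smul_nhdsGT (1 : ℝ)
    have h1 := (hφ.rescaled_increment_isLittleO z).tendsto_div_nhds_zero
    have hlog : HasFDerivAt (fun x => Real.log (ω x)) (fderiv ℝ (fun x => Real.log (ω x)) x₀) x₀ :=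
      ((hω.differentiableAt (by simp)).log hpos.ne').hasFDerivAt
    have h2 : Tendsto (fun ε : ℝ => (Real.log (ω (x₀ + √ε • z)) - Real.log (ω x₀)) / √ε)
        (𝓝[>] 0) (𝓝 (fderiv ℝ (fun x => Real.log (ω x)) x₀ z)) := by
      have hl := hlog.hasLineDerivAt z
      have h3 := hl.tendsto_slope_zero_right
      have h4 : Tendsto (fun ε : ℝ => √ε) (𝓝[>] 0) (𝓝[>] 0) :=
        tendsto_nhdsWithin_iff.2 ⟨hsq0, by
          filter_upwards [self_mem_nhdsWithin] with ε hε using Real.sqrt_pos.2 hε⟩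
      refine (h3.comp h4).congr fun ε => ?_
      simp [div_eq_inv_mul]
    have h3 : Tendsto (fun ε : ℝ => r ε / √ε) (𝓝[>] 0) (𝓝 0) := by
      have h4 := hsq0.const_mul C
      rw [mul_zero] at h4
      refine squeeze_zero_norm' ?_ h4
      filter_upwards [hr, self_mem_nhdsWithin] with ε hε hε0
      have hs : 0 < √ε := Real.sqrt_pos.2 hε0
      rw [norm_div, Real.norm_of_nonneg hs.le, div_le_iff₀ hs, mul_assoc,
        Real.mul_self_sqrt (le_of_lt hε0)]
      exact hε.1
    have h5 := ((h2.add h3).sub h1).sub_const (iteratedFDeriv ℝ 3 φ x₀ (fun _ => z) / 6)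
    simp only [add_zero, sub_zero] at h5
    refine h5.congr' ?_
    filter_upwards [self_mem_nhdsWithin] with ε hε0
    have hs : 0 < √ε := Real.sqrt_pos.2 hε0
    simp only [h0, zero_apply, zero_div, zero_add]
    generalize (φ (x₀ + √ε • z) - φ x₀) / ε = y
    field_simp
    ring
  · filter_upwards [hr] with ε hε
    rw [hε.2]
    simp only [smul_zero, add_zero, sub_self, zero_div, sub_zero]
    congr 2
    ring

/-- When `∇φ(x₀) = 0`, comparing the two expansions gives the first two coefficients of the one on
the scale of the central limit theorem up to their values at the origin. -/
theorem HasWKBExpansion.clt_coefficients (h : HasWKBExpansion q a φ ω x₀)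
    (hq : HasCLTExpansion q x₀ p₀ p₁)
    (hφ : ContDiffAt ℝ 3 φ x₀) (hω : ContDiffAt ℝ 1 ω x₀) (hpos : 0 < ω x₀)
    (h0 : fderiv ℝ φ x₀ = 0) (z : Euc n) :
    p₀ z = p₀ 0 * Real.exp (-(iteratedFDeriv ℝ 2 φ x₀ (fun _ => z) / 2)) ∧
    p₁ z = p₁ 0 * Real.exp (-(iteratedFDeriv ℝ 2 φ x₀ (fun _ => z) / 2)) +
      p₀ z * (fderiv ℝ (fun x => Real.log (ω x)) x₀ z
        - iteratedFDeriv ℝ 3 φ x₀ (fun _ => z) / 6) := by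
  obtain ⟨e, he, heq⟩ := h.exists_eventually_eq_mul_exp hφ hω hpos h0 z
  set Q := iteratedFDeriv ℝ 2 φ x₀ (fun _ => z) / 2
  set κ := fderiv ℝ (fun x => Real.log (ω x)) x₀ z - iteratedFDeriv ℝ 3 φ x₀ (fun _ => z) / 6
  have hsq0 : Tendsto (fun ε : ℝ => √ε) (𝓝[>] 0) (𝓝 0) := by
    simpa using tendsto_sqrt_smul_nhdsGT (1 : ℝ)
  have hspos : ∀ᶠ ε : ℝ in 𝓝[>] 0, 0 < √ε := by
    filter_upwards [self_mem_nhdsWithin] with ε hε using Real.sqrt_pos.2 hε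
  have hlim := hq.tendsto_cltScaled
  have hquot := hq.tendsto_quotient
  have he0 : Tendsto e (𝓝[>] 0) (𝓝 0) := by
    have := he.mul hsq0
    rw [mul_zero] at this
    refine this.congr' ?_
    filter_upwards [hspos] with ε hs
    field_simp
  have hexp : Tendsto (fun ε => Real.exp (-Q + e ε)) (𝓝[>] 0) (𝓝 (Real.exp (-Q))) := by
    have := (Real.continuous_exp.tendsto _).comp (he0.const_add (-Q))
    simpa [Function.comp_def] using this
  have hp₀ : p₀ z = p₀ 0 * Real.exp (-Q) :=
    tendsto_nhds_unique (hlim z) (((hlim 0).mul hexp).congr' (heq.mono fun _ h => h.symm))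
  refine ⟨hp₀, ?_⟩
  have hdexp : Tendsto (fun ε => (Real.exp (e ε) - 1) / √ε) (𝓝[>] 0) (𝓝 κ) := by
    have h1 : Tendsto (fun ε => (Real.exp (e ε) - 1 - e ε) / √ε) (𝓝[>] 0) (𝓝 0) := by
      have h2 : Tendsto (fun ε => |e ε / √ε| * |e ε|) (𝓝[>] 0) (𝓝 0) := by
        simpa using he.abs.mul he0.abs
      refine squeeze_zero_norm' ?_ h2
      filter_upwards [hspos, he0.abs.eventually_lt_const
        (show |(0 : ℝ)| < 1 by simp)] with ε hs he1
      rw [norm_div, Real.norm_of_nonneg hs.le, abs_div, abs_of_pos hs, div_mul_eq_mul_div,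
        abs_mul_abs_self, ← pow_two]
      gcongr
      exact Real.abs_exp_sub_one_sub_id_le he1.le
    have h3 := h1.add he
    rw [zero_add] at h3
    refine h3.congr fun ε => ?_
    ring
  have hprod := ((hquot 0).mul hexp).add
    ((hdexp.const_mul (p₀ 0 * Real.exp (-Q))))
  rw [hp₀]
  refine tendsto_nhds_unique (hquot z) (hprod.congr' ?_)
  filter_upwards [heq] with ε hε
  rw [hε, hp₀, Real.exp_add]
  ring

end WKB

/-! ### The limit law -/

/-- Expectations of the rescaled variable `(Y - x₀) / √ε` in terms of the rescaled density. -/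
theorem IsDensityOf.integral_comp_rescale {n : ℕ} {Ω : Type*} [MeasurableSpace Ω] {P : Measure Ω}
    {Y : Ω → Euc n} {q : Euc n → ℝ} (h : IsDensityOf P Y q) (hY : AEMeasurable Y P) {ε : ℝ}
    (hε : 0 < ε) (x₀ : Euc n) {f : Euc n → ℝ} (hf : Continuous f) :
    ∫ ω, f ((√ε)⁻¹ • (Y ω - x₀)) ∂P = ∫ z, f z * cltScaled ε x₀ q z := by
  have hs : 0 < √ε := Real.sqrt_pos.2 hε
  have hg : Continuous fun x => f ((√ε)⁻¹ • (x - x₀)) := hf.comp (by fun_prop)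
  have h1 := integral_map hY (f := fun x => f ((√ε)⁻¹ • (x - x₀))) hg.aestronglyMeasurable
  rw [← h1, h.map_eq, integral_withDensity_eq_integral_toReal_smul
    (h.measurable.ennreal_ofReal) (by simp)]
  have h2 := Measure.integral_comp_smul (volume : Measure (Euc n))
    (fun u => q (x₀ + u) * f ((√ε)⁻¹ • u)) √ε
  have h3 := integral_add_left_eq_self (μ := (volume : Measure (Euc n)))
    (fun x => q x * f ((√ε)⁻¹ • (x - x₀))) x₀
  simp only [add_sub_cancel_left] at h3
  have h4 : ε ^ ((n : ℝ) / 2) = √ε ^ n := by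
    rw [Real.sqrt_eq_rpow, ← Real.rpow_natCast, ← Real.rpow_mul hε.le]
    congr 1
    ring
  have hsn : 0 < √ε ^ n := by positivity
  rw [h3, finrank_euclideanSpace_fin, abs_of_pos (by positivity), smul_eq_mul,
    eq_inv_mul_iff_mul_eq₀ hsn.ne'] at h2
  simp only [ENNReal.toReal_ofReal (h.nonneg _), smul_eq_mul]
  rw [← h2, ← integral_const_mul]
  congr 1
  ext z
  rw [cltScaled, h4, inv_smul_smul₀ hs.ne']
  ring

/-- If rescaled variables converge almost surely and their densities converge pointwise and
boundedly on bounded sets, then the limit of the densities is the density of the limit. -/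
theorem map_eq_withDensity_of_tendsto_cltScaled {n : ℕ} {Ω : Type*} [MeasurableSpace Ω]
    {P : Measure Ω} [IsProbabilityMeasure P] {q : ℝ → Euc n → ℝ} {x₀ : Euc n} {p₀ : Euc n → ℝ}
    {Y : Ω → Euc n} {X : ℝ → Ω → Euc n} {ε : ℕ → ℝ} (hε : Tendsto ε atTop (𝓝[>] 0))
    (hpos : ∀ k, 0 < ε k) (hdens : ∀ k, IsDensityOf P (X (ε k)) (q (ε k)))
    (hX : ∀ k, AEMeasurable (X (ε k)) P) (hY : AEMeasurable Y P)
    (hlim : ∀ᵐ ω ∂P, Tendsto (fun k => (√(ε k))⁻¹ • (X (ε k) ω - x₀)) atTop (𝓝 (Y ω)))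
    (hq : ∀ z, Tendsto (fun ε => cltScaled ε x₀ (q ε) z) (𝓝[>] 0) (𝓝 (p₀ z)))
    (hbdd : ∀ R, 0 ≤ R →
      ∃ K, ∀ᶠ ε in 𝓝[>] (0 : ℝ), ∀ z, ‖z‖ ≤ R → |cltScaled ε x₀ (q ε) z| ≤ K)
    (hp₀ : Continuous p₀) (hp₀' : ∀ z, 0 ≤ p₀ z) :
    P.map Y = volume.withDensity fun z => ENNReal.ofReal (p₀ z) := by
  have : IsProbabilityMeasure (P.map Y) := Measure.isProbabilityMeasure_map hY
  have : IsLocallyFiniteMeasure (volume.withDensity fun z => ENNReal.ofReal (p₀ z)) :=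
    IsLocallyFiniteMeasure.withDensity_ofReal hp₀
  refine Measure.ext_of_integral_eq_on_compactlySupported fun f => ?_
  have hfc : Continuous f := f.continuous
  obtain ⟨M, hM⟩ := hfc.bounded_above_of_compact_support f.hasCompactSupport
  obtain ⟨R, hR0, hR⟩ : ∃ R, 0 ≤ R ∧ ∀ z, R < ‖z‖ → f z = 0 := by
    obtain ⟨R, hR⟩ := f.hasCompactSupport.isCompact.isBounded.subset_closedBall (0 : Euc n)
    refine ⟨max R 0, le_max_right _ _, fun z hz => ?_⟩
    by_contra hne
    have := hR (subset_tsupport f hne)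
    rw [mem_closedBall_zero_iff] at this
    exact absurd hz (not_lt.2 (this.trans (le_max_left _ _)))
  obtain ⟨K, hK⟩ := hbdd R hR0
  have hM0 : 0 ≤ M := (norm_nonneg _).trans (hM 0)
  have hmeas : ∀ k, AEStronglyMeasurable (fun z => f z * cltScaled (ε k) x₀ (q (ε k)) z)
      (volume : Measure (Euc n)) := by
    intro k
    have h1 : Measurable fun z : Euc n => q (ε k) (x₀ + √(ε k) • z) :=
      (hdens k).measurable.comp (by fun_prop)
    exact (hfc.measurable.mul (h1.const_mul _)).aestronglyMeasurable
  have lim1 : Tendsto (fun k => ∫ z, f z * cltScaled (ε k) x₀ (q (ε k)) z) atTop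
      (𝓝 (∫ z, f z * p₀ z)) := by
    refine tendsto_integral_filter_of_dominated_convergence
      ((Metric.closedBall (0 : Euc n) R).indicator fun _ => M * |K|)
      (Eventually.of_forall hmeas) ?_ ?_ ?_
    · filter_upwards [hε.eventually hK] with k hk
      refine Eventually.of_forall fun z => ?_
      by_cases hz : ‖z‖ ≤ R
      · rw [indicator_of_mem (by simpa using hz), norm_mul]
        exact mul_le_mul (hM z) ((hk z hz).trans (le_abs_self K)) (norm_nonneg _) hM0
      · rw [hR z (not_le.1 hz), zero_mul, norm_zero]
        exact indicator_nonneg (fun _ _ => by positivity) _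
    · rw [integrable_indicator_iff Metric.isClosed_closedBall.measurableSet]
      exact integrableOn_const (isCompact_closedBall _ _).measure_lt_top.ne
    · exact Eventually.of_forall fun z => ((hq z).comp hε).const_mul (f z)
  have lim2 : Tendsto (fun k => ∫ ω, f ((√(ε k))⁻¹ • (X (ε k) ω - x₀)) ∂P) atTop
      (𝓝 (∫ ω, f (Y ω) ∂P)) := by
    refine tendsto_integral_of_dominated_convergence (fun _ => M) (fun k => ?_)
      (integrable_const M) (fun k => Eventually.of_forall fun ω => hM _) ?_
    · exact (hfc.measurable.comp_aemeasurable
        (((hX k).sub_const x₀).const_smul (√(ε k))⁻¹)).aestronglyMeasurable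
    · filter_upwards [hlim] with ω hω using (hfc.tendsto _).comp hω
  have heq : ∫ ω, f (Y ω) ∂P = ∫ z, f z * p₀ z := by
    refine tendsto_nhds_unique lim2 (lim1.congr fun k => ?_)
    exact ((hdens k).integral_comp_rescale (hX k) (hpos k) x₀ hfc).symm
  rw [integral_map hY hfc.aestronglyMeasurable, heq,
    integral_withDensity_eq_integral_toReal_smul (hp₀.measurable.ennreal_ofReal) (by simp)]
  simp only [ENNReal.toReal_ofReal (hp₀' _), smul_eq_mul, mul_comm]

/-! ### Gaussian integrals -/

/-- A positive integrable function on a Euclidean space has no nontrivial period. The integral of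
`f · arctan ⟪v, ·⟫` would strictly increase under translation by a period `v ≠ 0`. -/
theorem eq_zero_of_integrable_of_periodic {n : ℕ} {f : Euc n → ℝ} (hf : Continuous f)
    (hfi : Integrable f) (hpos : ∀ z, 0 < f z) {v : Euc n} (hv : ∀ z, f (z + v) = f z) :
    v = 0 := by
  by_contra hne
  have hvv : 0 < inner ℝ v v := real_inner_self_pos.2 hne
  have hi : ∀ c : ℝ, Integrable fun z => f z * Real.arctan (inner ℝ v z + c) := by
    intro c
    refine hfi.mul_bdd (c := Real.pi / 2) (by fun_prop) (Eventually.of_forall fun z => ?_)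
    rw [Real.norm_eq_abs]
    exact (abs_lt.2 ⟨Real.neg_pi_div_two_lt_arctan _, Real.arctan_lt_pi_div_two _⟩).le
  have h1 := integral_add_right_eq_self (μ := (volume : Measure (Euc n)))
    (fun z => f z * Real.arctan (inner ℝ v z + 0)) v
  simp only [hv, inner_add_right, add_zero] at h1
  have h2 : 0 < ∫ z, f z * Real.arctan (inner ℝ v z + inner ℝ v v)
      - f z * Real.arctan (inner ℝ v z + 0) := by
    have hlt : ∀ z, 0 < f z * Real.arctan (inner ℝ v z + inner ℝ v v)
        - f z * Real.arctan (inner ℝ v z + 0) := by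
      intro z
      have := Real.arctan_strictMono (show inner ℝ v z + 0 < inner ℝ v z + inner ℝ v v by linarith)
      have := mul_lt_mul_of_pos_left this (hpos z)
      linarith
    exact integral_pos_of_integrable_nonneg_nonzero (x := 0) (by fun_prop)
      ((hi _).sub (hi 0)) (fun z => (hlt z).le) (hlt 0).ne'
  rw [integral_sub (hi _) (hi 0)] at h2
  simp only [add_zero] at h2
  linarith

/-- The quadratic form of a matrix on a Euclidean space. -/
noncomputable def quadForm {n : ℕ} (H : Matrix (Fin n) (Fin n) ℝ) (z : Euc n) : ℝ :=
  z.ofLp ⬝ᵥ H *ᵥ z.ofLp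

theorem continuous_quadForm {n : ℕ} (H : Matrix (Fin n) (Fin n) ℝ) : Continuous (quadForm H) := by
  unfold quadForm
  simp only [dotProduct, Matrix.mulVec]
  fun_prop

/-- A symmetric matrix with integrable Gaussian weight is positive definite. By the parallelogram
identity, symmetrised translation by `v` multiplies the weight by at least `exp(-Q(v)/2)`, so that
`Q(v) ≥ 0`; and a `v` with `Q(v) = 0` is a period of the weight. -/
theorem Matrix.posDef_of_integrable_exp_quadForm {n : ℕ} {H : Matrix (Fin n) (Fin n) ℝ}
    (hH : H.IsHermitian) (hi : Integrable fun z : Euc n => Real.exp (-(quadForm H z / 2))) :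
    H.PosDef := by
  have hc := continuous_quadForm H
  have hIpos : 0 < ∫ z : Euc n, Real.exp (-(quadForm H z / 2)) :=
    integral_pos_of_integrable_nonneg_nonzero (x := 0) (by fun_prop) hi
      (fun z => (Real.exp_pos _).le) (Real.exp_pos _).ne'
  have hnonneg : ∀ v : Euc n, 0 ≤ quadForm H v := by
    intro v
    have h1 : ∀ z, 2 * Real.exp (-(quadForm H v / 2)) * Real.exp (-(quadForm H z / 2)) ≤
        Real.exp (-(quadForm H (z + v) / 2)) + Real.exp (-(quadForm H (z - v) / 2)) := by
      intro z
      have hpar : quadForm H (z + v) + quadForm H (z - v)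
          = 2 * quadForm H z + 2 * quadForm H v := by
        simp only [quadForm, WithLp.ofLp_add, WithLp.ofLp_sub, Matrix.mulVec_add, Matrix.mulVec_sub,
          dotProduct_add, dotProduct_sub, add_dotProduct, sub_dotProduct]
        ring
      have e1 : ∀ x : ℝ, Real.exp (-(x / 2)) = Real.exp (-(x / 4)) ^ 2 := by
        intro x
        rw [← Real.exp_nat_mul]
        congr 1
        push_cast
        ring
      have e2 : Real.exp (-(quadForm H v / 2)) * Real.exp (-(quadForm H z / 2))
          = Real.exp (-(quadForm H (z + v) / 4)) * Real.exp (-(quadForm H (z - v) / 4)) := by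
        rw [← Real.exp_add, ← Real.exp_add]
        congr 1
        linarith
      rw [mul_assoc, e2, e1 (quadForm H (z + v)), e1 (quadForm H (z - v))]
      nlinarith [sq_nonneg (Real.exp (-(quadForm H (z + v) / 4))
        - Real.exp (-(quadForm H (z - v) / 4)))]
    have h2 := integral_mono (hi.const_mul _) ((hi.comp_add_right v).add (hi.comp_sub_right v)) h1
    simp only [Pi.add_apply] at h2
    rw [integral_const_mul, integral_add (hi.comp_add_right v) (hi.comp_sub_right v),
      integral_add_right_eq_self (fun z => Real.exp (-(quadForm H z / 2))) v,
      integral_sub_right_eq_self (fun z => Real.exp (-(quadForm H z / 2))) v] at h2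
    have h3 : Real.exp (-(quadForm H v / 2)) ≤ 1 := by
      by_contra! h
      nlinarith
    rw [Real.exp_le_one_iff] at h3
    linarith
  have hpsd : H.PosSemidef := .of_dotProduct_mulVec_nonneg hH fun x => by
    simpa [quadForm] using hnonneg (WithLp.toLp 2 x)
  refine .of_dotProduct_mulVec_pos hH fun x hx => ?_
  refine lt_of_le_of_ne (by simpa [quadForm] using hnonneg (WithLp.toLp 2 x)) fun h0 => hx ?_
  have hHx : H *ᵥ x = 0 := (hpsd.dotProduct_mulVec_zero_iff x).1 h0.symm
  have hxH : ∀ y : Fin n → ℝ, x ⬝ᵥ H *ᵥ y = 0 := by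
    intro y
    rw [Matrix.dotProduct_mulVec, ← Matrix.mulVec_transpose]
    have : Hᵀ = H := by simpa [Matrix.IsHermitian] using hH
    rw [this, hHx, zero_dotProduct]
  have := eq_zero_of_integrable_of_periodic (v := WithLp.toLp 2 x) (by fun_prop) hi
    (fun z => Real.exp_pos _) (fun z => by
      simp [quadForm, Matrix.mulVec_add, hHx, hxH])
  simpa using congrArg WithLp.ofLp this

theorem integral_exp_neg_sq_div_two : ∫ x : ℝ, Real.exp (-(x ^ 2 / 2)) = √(2 * Real.pi) := by
  have := integral_gaussian (1 / 2)
  rw [show Real.pi / (1 / 2) = 2 * Real.pi by ring] at this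
  rw [← this]
  congr 1
  ext x
  congr 1
  ring

theorem integral_sq_mul_exp_neg_sq_div_two :
    ∫ x : ℝ, x * x * Real.exp (-(x ^ 2 / 2)) = √(2 * Real.pi) := by
  have h1 : ∫ x, x ^ 2 ∂(gaussianReal 0 1) = 1 := by
    have := variance_id_gaussianReal (μ := 0) (v := 1)
    rw [variance_eq_integral (by fun_prop)] at this
    simpa using this
  rw [integral_gaussianReal_eq_integral_smul one_ne_zero] at h1
  have hs : 0 < √(2 * Real.pi) := by positivity
  have h2 : ∀ x : ℝ, gaussianPDFReal 0 1 x • x ^ 2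
      = (√(2 * Real.pi))⁻¹ * (x * x * Real.exp (-(x ^ 2 / 2))) := by
    intro x
    simp [gaussianPDFReal]
    ring_nf
  simp_rw [h2, integral_const_mul] at h1
  field_simp at h1
  simpa only [pow_two] using h1

theorem integral_id_mul_exp_neg_sq_div_two : ∫ x : ℝ, x * Real.exp (-(x ^ 2 / 2)) = 0 := by
  have := integral_neg_eq_self (fun x : ℝ => x * Real.exp (-(x ^ 2 / 2))) volume
  simp only [neg_mul, even_two.neg_pow, integral_neg] at this
  linarith

theorem two_pi_rpow_half (n : ℕ) : (2 * Real.pi) ^ ((n : ℝ) / 2) = √(2 * Real.pi) ^ n := by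
  rw [Real.sqrt_eq_rpow, ← Real.rpow_natCast, ← Real.rpow_mul (by positivity)]
  congr 1
  ring

theorem integral_prod_mul_exp_neg_norm_sq {n : ℕ} (g : Fin n → ℝ → ℝ) :
    ∫ y : Euc n, (∏ k, g k (y k)) * Real.exp (-(‖y‖ ^ 2 / 2))
      = ∏ k, ∫ x : ℝ, g k x * Real.exp (-(x ^ 2 / 2)) := by
  rw [← integral_fintype_prod_volume_eq_prod (fun k x => g k x * Real.exp (-(x ^ 2 / 2))),
    ← (PiLp.volume_preserving_toLp (Fin n)).integral_comp
      (MeasurableEquiv.toLp 2 _).measurableEmbedding]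
  congr 1
  ext y
  rw [Finset.prod_mul_distrib, ← Real.exp_sum, EuclideanSpace.real_norm_sq_eq]
  simp [Finset.sum_div]

theorem integral_exp_neg_norm_sq {n : ℕ} :
    ∫ y : Euc n, Real.exp (-(‖y‖ ^ 2 / 2)) = (2 * Real.pi) ^ ((n : ℝ) / 2) := by
  have := integral_prod_mul_exp_neg_norm_sq (n := n) fun _ _ => 1
  simpa [integral_exp_neg_sq_div_two, two_pi_rpow_half] using this

theorem integral_coord_mul_coord_mul_exp_neg_norm_sq {n : ℕ} (i j : Fin n) :
    ∫ y : Euc n, y i * y j * Real.exp (-(‖y‖ ^ 2 / 2))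
      = if i = j then (2 * Real.pi) ^ ((n : ℝ) / 2) else 0 := by
  have h := integral_prod_mul_exp_neg_norm_sq (n := n)
    fun k x => (if k = i then x else 1) * (if k = j then x else 1)
  simp only [Finset.prod_mul_distrib, Finset.prod_ite_eq', Finset.mem_univ, if_true] at h
  rw [h]
  split_ifs with hij
  · subst hij
    suffices hk : ∀ k ∈ Finset.univ, ∫ x : ℝ, ((if k = i then x else 1) * if k = i then x else 1)
        * Real.exp (-(x ^ 2 / 2)) = √(2 * Real.pi) by
      rw [two_pi_rpow_half, Finset.prod_congr rfl hk]
      simp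
    intro k _
    by_cases hk : k = i
    · simp [hk, integral_sq_mul_exp_neg_sq_div_two]
    · simp [hk, integral_exp_neg_sq_div_two]
  · exact Finset.prod_eq_zero (Finset.mem_univ i)
      (by simp [hij, integral_id_mul_exp_neg_sq_div_two])

theorem integrable_norm_pow_mul_exp_neg_norm_sq {n : ℕ} (m : ℕ) :
    Integrable fun y : Euc n => ‖y‖ ^ m * Real.exp (-(‖y‖ ^ 2 / 2)) := by
  have h1 : Integrable fun y : Euc n => Real.exp (-(‖y‖ ^ 2 / 4)) := by
    have := (GaussianFourier.integrable_cexp_neg_mul_sq_norm_add (V := Euc n) (b := (1 / 4 : ℂ))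
      (by norm_num) 0 0).norm
    refine this.congr (Eventually.of_forall fun y => ?_)
    have e : (-(1 / 4 : ℂ) * (‖y‖ : ℂ) ^ 2 + 0 * ((inner ℝ (0 : Euc n) y : ℝ) : ℂ))
        = ((-(‖y‖ ^ 2 / 4) : ℝ) : ℂ) := by
      push_cast
      ring
    simp only [e, Complex.norm_exp_ofReal]
  refine (h1.const_mul (m.factorial * Real.exp 1)).mono' (by fun_prop)
    (Eventually.of_forall fun y => ?_)
  have h2 := Real.pow_div_factorial_le_exp ‖y‖ (norm_nonneg y) m
  rw [div_le_iff₀ (by positivity)] at h2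
  rw [Real.norm_of_nonneg (by positivity)]
  calc _ ≤ Real.exp ‖y‖ * m.factorial * Real.exp (-(‖y‖ ^ 2 / 2)) := by gcongr
    _ = m.factorial * Real.exp (‖y‖ - ‖y‖ ^ 2 / 2) := by
        rw [sub_eq_add_neg, Real.exp_add]; ring
    _ ≤ m.factorial * Real.exp (1 + -(‖y‖ ^ 2 / 4)) := by
        gcongr
        nlinarith [sq_nonneg (‖y‖ / 2 - 1)]
    _ = _ := by rw [Real.exp_add]; ring

section Whitening

variable {n : ℕ} {H S : Matrix (Fin n) (Fin n) ℝ}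

theorem Matrix.PosDef.det_ne_zero_of_mul_transpose_eq_inv (hH : H.PosDef) (hS : S * Sᵀ = H⁻¹) :
    S.det ≠ 0 := by
  intro h
  have h1 := congrArg Matrix.det hS
  rw [Matrix.det_mul, h, zero_mul] at h1
  exact hH.inv.det_pos.ne h1

theorem Matrix.PosDef.quadForm_toEuclideanCLM (hH : H.PosDef) (hS : S * Sᵀ = H⁻¹) (y : Euc n) :
    quadForm H (Matrix.toEuclideanCLM (𝕜 := ℝ) S y) = ‖y‖ ^ 2 := by
  have hdet := hH.det_ne_zero_of_mul_transpose_eq_inv hS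
  have hSu : IsUnit S.det := hdet.isUnit
  have hHu : IsUnit H.det := hH.det_pos.ne'.isUnit
  have h1 : H * S * Sᵀ = 1 := by rw [mul_assoc, hS, Matrix.mul_nonsing_inv _ hHu]
  have h2 : Sᵀ * (H * S) = 1 := mul_eq_one_comm.1 h1
  rw [quadForm, Matrix.ofLp_toEuclideanCLM, Matrix.mulVec_mulVec, Matrix.dotProduct_mulVec,
    ← Matrix.vecMul_transpose, Matrix.vecMul_vecMul, h2, Matrix.vecMul_one,
    EuclideanSpace.real_norm_sq_eq]
  simp [dotProduct, pow_two]

/-- The substitution `z = S y`, with `S Sᵀ = H⁻¹`, turns the Gaussian weight of `H` into the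
standard one. -/
theorem Matrix.PosDef.integral_mul_exp_quadForm (hH : H.PosDef) (hS : S * Sᵀ = H⁻¹)
    (g : Euc n → ℝ) :
    (Integrable (fun y => g (Matrix.toEuclideanCLM (𝕜 := ℝ) S y) * Real.exp (-(‖y‖ ^ 2 / 2))) →
      Integrable fun z => g z * Real.exp (-(quadForm H z / 2))) ∧
    ∫ z, g z * Real.exp (-(quadForm H z / 2)) = |S.det| *
      ∫ y, g (Matrix.toEuclideanCLM (𝕜 := ℝ) S y) * Real.exp (-(‖y‖ ^ 2 / 2)) := by
  have hdet := hH.det_ne_zero_of_mul_transpose_eq_inv hS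
  set L := Matrix.toEuclideanCLM (𝕜 := ℝ) S with hL
  have hLdet : LinearMap.det (L : Euc n →ₗ[ℝ] Euc n) = S.det := by
    rw [hL, Matrix.coe_toEuclideanCLM_eq_toEuclideanLin]
    exact LinearMap.det_toLpLin 2 S
  have hemb : MeasurableEmbedding L :=
    (LinearEquiv.toContinuousLinearEquiv (LinearMap.equivOfDetNeZero (L : Euc n →ₗ[ℝ] Euc n)
      (by rwa [hLdet]))).toHomeomorph.measurableEmbedding
  have hmap := Measure.map_linearMap_addHaar_eq_smul_addHaar (volume : Measure (Euc n))
    (f := (L : Euc n →ₗ[ℝ] Euc n)) (by rwa [hLdet])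
  rw [hLdet] at hmap
  replace hmap : Measure.map L volume = ENNReal.ofReal |S.det⁻¹| • (volume : Measure (Euc n)) :=
    hmap
  have hne : ENNReal.ofReal |S.det⁻¹| ≠ 0 := by simpa using hdet
  have hQ : ∀ y, quadForm H (L y) = ‖y‖ ^ 2 := hH.quadForm_toEuclideanCLM hS
  constructor
  · intro hint
    have h1 : Integrable (fun z => g z * Real.exp (-(quadForm H z / 2)))
        (Measure.map L volume) := by
      rw [hemb.integrable_map_iff]
      simpa only [Function.comp_def, hQ] using hint
    rw [hmap] at h1
    exact (integrable_smul_measure hne ENNReal.ofReal_ne_top).1 h1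
  · have h1 := hemb.integral_map (μ := volume) fun z => g z * Real.exp (-(quadForm H z / 2))
    rw [hmap, integral_smul_measure, ENNReal.toReal_ofReal (abs_nonneg _), smul_eq_mul] at h1
    simp only [hQ] at h1
    rw [← h1, ← mul_assoc, abs_inv, mul_inv_cancel₀ (abs_ne_zero.2 hdet), one_mul]

open scoped MatrixOrder in
theorem Matrix.PosDef.exists_mul_transpose_eq_inv (hH : H.PosDef) :
    ∃ S : Matrix (Fin n) (Fin n) ℝ, S * Sᵀ = H⁻¹ := by
  refine ⟨CFC.sqrt H⁻¹, ?_⟩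
  have h : (CFC.sqrt H⁻¹)ᵀ = CFC.sqrt H⁻¹ := by
    simpa [Matrix.star_eq_conjTranspose] using (CFC.sqrt_nonneg H⁻¹).isSelfAdjoint.star_eq
  rw [h, CFC.sqrt_mul_sqrt_self _ hH.inv.posSemidef.nonneg]

theorem Matrix.PosDef.integrable_mul_exp_quadForm (hH : H.PosDef) {g : Euc n → ℝ}
    (hg : Continuous g) {C : ℝ} {m : ℕ} (hgC : ∀ z, |g z| ≤ C * ‖z‖ ^ m) :
    Integrable fun z => g z * Real.exp (-(quadForm H z / 2)) := by
  obtain ⟨S, hS⟩ := hH.exists_mul_transpose_eq_inv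
  refine (hH.integral_mul_exp_quadForm hS g).1 ?_
  set L := Matrix.toEuclideanCLM (𝕜 := ℝ) S
  refine ((integrable_norm_pow_mul_exp_neg_norm_sq m).const_mul (|C| * ‖L‖ ^ m)).mono'
    (by fun_prop) (Eventually.of_forall fun y => ?_)
  rw [norm_mul, Real.norm_eq_abs, Real.norm_of_nonneg (Real.exp_pos _).le, mul_assoc,
    ← mul_assoc (‖L‖ ^ m), ← mul_pow, ← mul_assoc]
  gcongr
  calc _ ≤ C * ‖L y‖ ^ m := hgC _
    _ ≤ |C| * ‖L y‖ ^ m := by gcongr; exact le_abs_self C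
    _ ≤ |C| * (‖L‖ * ‖y‖) ^ m := by gcongr; exact L.le_opNorm y

end Whitening

theorem toEuclideanCLM_apply_coord {n : ℕ} (S : Matrix (Fin n) (Fin n) ℝ) (y : Euc n) (i : Fin n) :
    Matrix.toEuclideanCLM (𝕜 := ℝ) S y i = ∑ j, S i j * y j := by
  simp [Matrix.ofLp_toEuclideanCLM, Matrix.mulVec, dotProduct]

/-! ### Moments of a normalised Gaussian density -/

section Moments

variable {n : ℕ} {H S : Matrix (Fin n) (Fin n) ℝ} {c : ℝ}

theorem abs_coord_le (z : Euc n) (i : Fin n) : |z i| ≤ ‖z‖ := PiLp.norm_apply_le z i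

theorem Matrix.PosDef.integrable_coord (hH : H.PosDef) (i : Fin n) :
    Integrable fun z : Euc n => z i * Real.exp (-(quadForm H z / 2)) :=
  hH.integrable_mul_exp_quadForm (C := 1) (m := 1) (by fun_prop)
    fun z => by simpa using abs_coord_le z i

theorem Matrix.PosDef.integrable_coord_mul_coord (hH : H.PosDef) (i j : Fin n) :
    Integrable fun z : Euc n => z i * z j * Real.exp (-(quadForm H z / 2)) :=
  hH.integrable_mul_exp_quadForm (C := 1) (m := 2) (by fun_prop) fun z => by
    rw [abs_mul, one_mul, pow_two]
    gcongr <;> exact abs_coord_le z _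

theorem Matrix.PosDef.integrable_coord_pow_four (hH : H.PosDef) (i j k l : Fin n) :
    Integrable fun z : Euc n => z i * z j * z k * z l * Real.exp (-(quadForm H z / 2)) :=
  hH.integrable_mul_exp_quadForm (C := 1) (m := 4) (by fun_prop) fun z => by
    rw [abs_mul, abs_mul, abs_mul, one_mul, pow_succ, pow_succ, pow_two]
    gcongr <;> exact abs_coord_le z _

theorem integral_coord_mul_exp_quadForm (i : Fin n) :
    ∫ z : Euc n, z i * Real.exp (-(quadForm H z / 2)) = 0 := by
  have := integral_neg_eq_self
    (fun z : Euc n => z i * Real.exp (-(quadForm H z / 2))) volume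
  simp only [quadForm, PiLp.neg_apply, WithLp.ofLp_neg, Matrix.mulVec_neg, neg_dotProduct_neg,
    neg_mul, integral_neg] at this
  simp only [quadForm]
  linarith

/-- Expectations under the normalised Gaussian density, computed in the variable `y = S⁻¹ z`. -/
theorem Matrix.PosDef.normalised_integral (hH : H.PosDef) (hS : S * Sᵀ = H⁻¹)
    (hc : c * ∫ z, Real.exp (-(quadForm H z / 2)) = 1) (g : Euc n → ℝ) :
    c * ∫ z, g z * Real.exp (-(quadForm H z / 2)) =
      ∫ y, g (Matrix.toEuclideanCLM (𝕜 := ℝ) S y) / (2 * Real.pi) ^ ((n : ℝ) / 2)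
        * Real.exp (-(‖y‖ ^ 2 / 2)) := by
  have h1 := (hH.integral_mul_exp_quadForm hS fun _ => 1).2
  simp only [one_mul] at h1
  rw [h1, integral_exp_neg_norm_sq] at hc
  rw [(hH.integral_mul_exp_quadForm hS g).2, ← mul_assoc, ← integral_const_mul]
  have hp : 0 < (2 * Real.pi) ^ ((n : ℝ) / 2) := by positivity
  have hcS : c * |S.det| = ((2 * Real.pi) ^ ((n : ℝ) / 2))⁻¹ := by
    rw [← mul_assoc] at hc
    exact eq_inv_of_mul_eq_one_left hc
  congr 1
  ext y
  rw [hcS]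
  ring

/-- The covariance matrix of the normalised Gaussian density is the inverse of its form. -/
theorem Matrix.PosDef.normalised_second_moment (hH : H.PosDef)
    (hc : c * ∫ z, Real.exp (-(quadForm H z / 2)) = 1) (i j : Fin n) :
    c * ∫ z : Euc n, z i * z j * Real.exp (-(quadForm H z / 2)) = H⁻¹ i j := by
  obtain ⟨S, hS⟩ := hH.exists_mul_transpose_eq_inv
  have hp : 0 < (2 * Real.pi) ^ ((n : ℝ) / 2) := by positivity
  have hint : ∀ μ ν : Fin n, Integrable fun y : Euc n => y μ * y ν * Real.exp (-(‖y‖ ^ 2 / 2)) := by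
    intro μ ν
    refine (integrable_norm_pow_mul_exp_neg_norm_sq 2).mono' (by fun_prop)
      (Eventually.of_forall fun y => ?_)
    rw [norm_mul, norm_mul, Real.norm_of_nonneg (Real.exp_pos _).le, pow_two]
    gcongr <;> exact PiLp.norm_apply_le y _
  rw [hH.normalised_integral hS hc fun z => z i * z j, ← hS]
  have e : ∀ y : Euc n, Matrix.toEuclideanCLM (𝕜 := ℝ) S y i * Matrix.toEuclideanCLM (𝕜 := ℝ) S y j
      / (2 * Real.pi) ^ ((n : ℝ) / 2) * Real.exp (-(‖y‖ ^ 2 / 2)) =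
      ∑ μ, ∑ ν, S i μ * S j ν / (2 * Real.pi) ^ ((n : ℝ) / 2) *
        (y μ * y ν * Real.exp (-(‖y‖ ^ 2 / 2))) := by
    intro y
    rw [toEuclideanCLM_apply_coord, toEuclideanCLM_apply_coord, Finset.sum_mul_sum]
    simp only [Finset.sum_div, Finset.sum_mul]
    refine Finset.sum_congr rfl fun μ _ => Finset.sum_congr rfl fun ν _ => ?_
    ring
  simp_rw [e]
  rw [integral_finsetSum _ fun μ _ => integrable_finsetSum _ fun ν _ => (hint μ ν).const_mul _]
  simp_rw [integral_finsetSum _ fun ν _ => (hint _ ν).const_mul _, integral_const_mul,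
    integral_coord_mul_coord_mul_exp_neg_norm_sq]
  simp only [mul_ite, mul_zero, Finset.sum_ite_eq, Finset.mem_univ, if_true, Matrix.mul_apply,
    Matrix.transpose_apply]
  refine Finset.sum_congr rfl fun μ _ => ?_
  field_simp

theorem Matrix.PosDef.normalised_fourth_moment (hH : H.PosDef) (hS : S * Sᵀ = H⁻¹)
    (hc : c * ∫ z, Real.exp (-(quadForm H z / 2)) = 1) (i j k l : Fin n) :
    c * ∫ z : Euc n, z i * z j * z k * z l * Real.exp (-(quadForm H z / 2)) =
      ∑ μ, ∑ ν, ∑ ρ, ∑ κ, S i μ * S j ν * S k ρ * S l κ * Theta μ ν ρ κ := by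
  have hint : ∀ μ ν ρ κ : Fin n, Integrable fun y : Euc n =>
      y μ * y ν * y ρ * y κ / (2 * Real.pi) ^ ((n : ℝ) / 2) * Real.exp (-(‖y‖ ^ 2 / 2)) := by
    intro μ ν ρ κ
    have h : Integrable fun y : Euc n => y μ * y ν * y ρ * y κ * Real.exp (-(‖y‖ ^ 2 / 2)) := by
      refine (integrable_norm_pow_mul_exp_neg_norm_sq 4).mono' (by fun_prop)
        (Eventually.of_forall fun y => ?_)
      rw [norm_mul, norm_mul, norm_mul, norm_mul, Real.norm_of_nonneg (Real.exp_pos _).le,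
        show ‖y‖ ^ 4 = ‖y‖ * ‖y‖ * ‖y‖ * ‖y‖ by ring]
      gcongr <;> exact PiLp.norm_apply_le y _
    refine (h.div_const ((2 * Real.pi) ^ ((n : ℝ) / 2))).congr (Eventually.of_forall fun y => ?_)
    simp only
    ring
  rw [hH.normalised_integral hS hc fun z => z i * z j * z k * z l]
  have e : ∀ y : Euc n, Matrix.toEuclideanCLM (𝕜 := ℝ) S y i * Matrix.toEuclideanCLM (𝕜 := ℝ) S y j
      * Matrix.toEuclideanCLM (𝕜 := ℝ) S y k * Matrix.toEuclideanCLM (𝕜 := ℝ) S y l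
      / (2 * Real.pi) ^ ((n : ℝ) / 2) * Real.exp (-(‖y‖ ^ 2 / 2)) =
      ∑ μ, ∑ ν, ∑ ρ, ∑ κ, S i μ * S j ν * S k ρ * S l κ *
        (y μ * y ν * y ρ * y κ / (2 * Real.pi) ^ ((n : ℝ) / 2) * Real.exp (-(‖y‖ ^ 2 / 2))) := by
    intro y
    rw [show ∀ a b c d : ℝ, a * b * c * d = d * c * b * a by intros; ring]
    simp only [toEuclideanCLM_apply_coord, Finset.sum_mul, Finset.mul_sum, Finset.sum_div]
    refine Finset.sum_congr rfl fun μ _ => Finset.sum_congr rfl fun ν _ =>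
      Finset.sum_congr rfl fun ρ _ => Finset.sum_congr rfl fun κ _ => ?_
    ring
  simp_rw [e]
  rw [integral_finsetSum _ fun μ _ => integrable_finsetSum _ fun ν _ =>
    integrable_finsetSum _ fun ρ _ => integrable_finsetSum _ fun κ _ =>
      (hint μ ν ρ κ).const_mul _]
  refine Finset.sum_congr rfl fun μ _ => ?_
  rw [integral_finsetSum _ fun ν _ => integrable_finsetSum _ fun ρ _ =>
    integrable_finsetSum _ fun κ _ => (hint μ ν ρ κ).const_mul _]
  refine Finset.sum_congr rfl fun ν _ => ?_
  rw [integral_finsetSum _ fun ρ _ => integrable_finsetSum _ fun κ _ =>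
    (hint μ ν ρ κ).const_mul _]
  refine Finset.sum_congr rfl fun ρ _ => ?_
  rw [integral_finsetSum _ fun κ _ => (hint μ ν ρ κ).const_mul _]
  refine Finset.sum_congr rfl fun κ _ => ?_
  rw [integral_const_mul, Theta]

end Moments

/-! ### Second and third derivatives in coordinates -/

section Coordinates

variable {n : ℕ} (f : Euc n → ℝ) (x : Euc n)

theorem quadForm_hessianMatrix (z : Euc n) :
    quadForm (hessianMatrix f x) z = iteratedFDeriv ℝ 2 f x fun _ => z := by
  have hz : z = ∑ i, z i • EuclideanSpace.single i (1 : ℝ) := by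
    simpa using ((EuclideanSpace.basisFun (Fin n) ℝ).sum_repr z).symm
  rw [iteratedFDeriv_two_apply]
  conv_rhs => rw [hz]
  simp only [map_sum, map_smul, sum_apply, smul_apply, smul_eq_mul, quadForm, hessianMatrix,
    dotProduct, Matrix.mulVec, Matrix.of_apply, iteratedFDeriv_two_apply, Matrix.cons_val_zero,
    Matrix.cons_val_one, Finset.mul_sum]
  rw [Finset.sum_comm]
  refine Finset.sum_congr rfl fun i _ => Finset.sum_congr rfl fun j _ => ?_
  ring

theorem iteratedFDeriv_three_diag (z : Euc n) :
    (iteratedFDeriv ℝ 3 f x fun _ => z) =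
      ∑ j, ∑ k, ∑ l, z j * z k * z l * thirdPartial f x j k l := by
  have hz : z = ∑ i, z i • EuclideanSpace.single i (1 : ℝ) := by
    simpa using ((EuclideanSpace.basisFun (Fin n) ℝ).sum_repr z).symm
  set M := iteratedFDeriv ℝ 3 f x with hM
  -- expand in one argument at a time
  have hi : ∀ (i : Fin 3) (m : Fin 3 → Euc n), M (Function.update m i z) =
      ∑ j, z j * M (Function.update m i (EuclideanSpace.single j 1)) := by
    intro i m
    have h := map_sum (M.toContinuousLinearMap m i) (fun j => z j • EuclideanSpace.single j (1 : ℝ))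
      Finset.univ
    rw [← hz] at h
    simpa using h
  have e0 : ∀ a b c d : Euc n, Function.update ![a, b, c] 0 d = ![d, b, c] := by
    intro a b c d; ext i; fin_cases i <;> rfl
  have e1 : ∀ a b c d : Euc n, Function.update ![a, b, c] 1 d = ![a, d, c] := by
    intro a b c d; ext i; fin_cases i <;> rfl
  have e2 : ∀ a b c d : Euc n, Function.update ![a, b, c] 2 d = ![a, b, d] := by
    intro a b c d; ext i; fin_cases i <;> rfl
  have hd : (fun _ : Fin 3 => z) = ![z, z, z] := by
    ext i; fin_cases i <;> rfl
  have h0 := hi 0 ![0, z, z]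
  simp only [e0] at h0
  rw [hd, h0]
  refine Finset.sum_congr rfl fun j _ => ?_
  have h1 := hi 1 ![EuclideanSpace.single j 1, 0, z]
  simp only [e1] at h1
  rw [h1, Finset.mul_sum]
  refine Finset.sum_congr rfl fun k _ => ?_
  have h2 := hi 2 ![EuclideanSpace.single j 1, EuclideanSpace.single k 1, 0]
  simp only [e2] at h2
  rw [h2, Finset.mul_sum, Finset.mul_sum]
  refine Finset.sum_congr rfl fun l _ => ?_
  rw [thirdPartial, ← hM]
  ring

theorem ContDiffAt.hessianMatrix_isHermitian {f : Euc n → ℝ} {x : Euc n}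
    (hf : ContDiffAt ℝ 3 f x) : (hessianMatrix f x).IsHermitian := by
  ext i j
  simp only [hessianMatrix, Matrix.conjTranspose_apply, Matrix.of_apply, star_trivial]
  exact IsSymmSndFDerivAt.iteratedFDeriv_cons
    (hf := hf.isSymmSndFDerivAt (by simp; norm_num))

end Coordinates

/-! ### The Gaussian limit and its first correction -/

theorem integral_comp_eq_of_map_eq_withDensity {n : ℕ} {Ω : Type*} [MeasurableSpace Ω]
    {P : Measure Ω} {Y : Ω → Euc n} (hY : AEMeasurable Y P) {p₀ : Euc n → ℝ} (hp₀ : Measurable p₀)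
    (hp₀' : ∀ z, 0 ≤ p₀ z) (h : P.map Y = volume.withDensity fun z => ENNReal.ofReal (p₀ z))
    {g : Euc n → ℝ} (hg : Continuous g) : ∫ ω, g (Y ω) ∂P = ∫ z, g z * p₀ z := by
  rw [← integral_map hY hg.aestronglyMeasurable, h,
    integral_withDensity_eq_integral_toReal_smul hp₀.ennreal_ofReal (by simp)]
  simp only [ENNReal.toReal_ofReal (hp₀' _), smul_eq_mul, mul_comm]

/-- A random vector with density `c exp(-Q/2)`, where `Q` is the form of a symmetric matrix `H`, is
a centred Gaussian vector: `H` is positive definite, `c` normalises the density, and the covariance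
matrix is `H⁻¹`. -/
theorem posDef_and_covMatrix_eq_of_map_eq {n : ℕ} {Ω : Type*} [MeasurableSpace Ω] {P : Measure Ω}
    [IsProbabilityMeasure P] {Y : Ω → Euc n} (hY : AEMeasurable Y P)
    {H : Matrix (Fin n) (Fin n) ℝ} (hH : H.IsHermitian) {c : ℝ} (hc : 0 ≤ c)
    (h : P.map Y =
      volume.withDensity fun z => ENNReal.ofReal (c * Real.exp (-(quadForm H z / 2)))) :
    H.PosDef ∧ c * ∫ z, Real.exp (-(quadForm H z / 2)) = 1 ∧ covMatrix P Y = H⁻¹ := by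
  have : IsProbabilityMeasure (P.map Y) := Measure.isProbabilityMeasure_map hY
  have hcont : Continuous fun z => c * Real.exp (-(quadForm H z / 2)) := by
    have := continuous_quadForm H
    fun_prop
  have hnn : ∀ z, 0 ≤ c * Real.exp (-(quadForm H z / 2)) := fun z => by positivity
  have hE : ∀ g : Euc n → ℝ, Continuous g →
      ∫ ω, g (Y ω) ∂P = c * ∫ z, g z * Real.exp (-(quadForm H z / 2)) := by
    intro g hg
    rw [integral_comp_eq_of_map_eq_withDensity hY hcont.measurable hnn h hg, ← integral_const_mul]
    congr 1
    ext z
    ring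
  have hone : c * ∫ z, Real.exp (-(quadForm H z / 2)) = 1 := by
    have := hE (fun _ => 1) continuous_const
    simpa using this.symm
  -- a non-integrable weight would have the junk integral `0`
  have hint : Integrable fun z => Real.exp (-(quadForm H z / 2)) := by
    by_contra hcon
    rw [integral_undef hcon, mul_zero] at hone
    exact zero_ne_one hone
  have hPD := Matrix.posDef_of_integrable_exp_quadForm hH hint
  refine ⟨hPD, hone, ?_⟩
  have hmean : ∀ i, ∫ ω, Y ω i ∂P = 0 := by
    intro i
    rw [hE (fun z => z i) (by fun_prop), integral_coord_mul_exp_quadForm, mul_zero]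
  ext i j
  simp only [covMatrix, Matrix.of_apply, covariance, hmean, sub_zero]
  rw [hE (fun z => z i * z j) (by fun_prop), hPD.normalised_second_moment hone]

/-- First moment of the first correction to a Gaussian density `p₀`, when the correction is a
multiple of the Gaussian weight plus `p₀` times an odd polynomial of third degree with linear part
`l` and cubic part `-T / 6`. -/
theorem Matrix.PosDef.integral_coord_mul_correction {n : ℕ} {H : Matrix (Fin n) (Fin n) ℝ}
    (hH : H.PosDef) {c : ℝ} (hc : c * ∫ z, Real.exp (-(quadForm H z / 2)) = 1) (c₁ : ℝ)
    (l : Fin n → ℝ) (T : Fin n → Fin n → Fin n → ℝ) {p₁ : Euc n → ℝ}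
    (hp₁ : ∀ z, p₁ z = c₁ * Real.exp (-(quadForm H z / 2)) +
      c * Real.exp (-(quadForm H z / 2)) *
        (∑ j, l j * z j - (∑ j, ∑ k, ∑ m, z j * z k * z m * T j k m) / 6)) (i : Fin n) :
    (Integrable fun z : Euc n => z i * p₁ z) ∧
    ∀ S : Matrix (Fin n) (Fin n) ℝ, S * Sᵀ = H⁻¹ →
      ∫ z : Euc n, z i * p₁ z = (H⁻¹ *ᵥ l) i - 1 / 6 * ∑ j, ∑ k, ∑ m, ∑ μ, ∑ ν, ∑ ρ, ∑ κ,
        T j k m * S i μ * S j ν * S k ρ * S m κ * Theta μ ν ρ κ := by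
  have e : ∀ z : Euc n, z i * p₁ z = c₁ * (z i * Real.exp (-(quadForm H z / 2))) +
      (∑ j, l j * (c * (z i * z j * Real.exp (-(quadForm H z / 2)))) -
      1 / 6 * ∑ j, ∑ k, ∑ m, T j k m *
        (c * (z i * z j * z k * z m * Real.exp (-(quadForm H z / 2))))) := by
    intro z
    have e1 : ∑ j, l j * (c * (z i * z j * Real.exp (-(quadForm H z / 2))))
        = c * Real.exp (-(quadForm H z / 2)) * z i * ∑ j, l j * z j := by
      rw [Finset.mul_sum]
      exact Finset.sum_congr rfl fun j _ => by ring
    have e2 : ∑ j, ∑ k, ∑ m, T j k m *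
        (c * (z i * z j * z k * z m * Real.exp (-(quadForm H z / 2))))
        = c * Real.exp (-(quadForm H z / 2)) * z i *
          ∑ j, ∑ k, ∑ m, z j * z k * z m * T j k m := by
      simp only [Finset.mul_sum]
      exact Finset.sum_congr rfl fun j _ => Finset.sum_congr rfl fun k _ =>
        Finset.sum_congr rfl fun m _ => by ring
    rw [hp₁, e1, e2]
    ring
  have i1 := (hH.integrable_coord i).const_mul c₁
  have i2 : ∀ j, Integrable fun z : Euc n =>
      l j * (c * (z i * z j * Real.exp (-(quadForm H z / 2)))) :=
    fun j => ((hH.integrable_coord_mul_coord i j).const_mul c).const_mul (l j)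
  have i3 : ∀ j k m, Integrable fun z : Euc n =>
      T j k m * (c * (z i * z j * z k * z m * Real.exp (-(quadForm H z / 2)))) :=
    fun j k m => ((hH.integrable_coord_pow_four i j k m).const_mul c).const_mul _
  have i3m : ∀ j k, Integrable fun z : Euc n => ∑ m,
      T j k m * (c * (z i * z j * z k * z m * Real.exp (-(quadForm H z / 2)))) :=
    fun j k => integrable_finsetSum _ fun m _ => i3 j k m
  have i3k : ∀ j, Integrable fun z : Euc n => ∑ k, ∑ m,
      T j k m * (c * (z i * z j * z k * z m * Real.exp (-(quadForm H z / 2)))) :=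
    fun j => integrable_finsetSum _ fun k _ => i3m j k
  have i2s := integrable_finsetSum Finset.univ fun j _ => i2 j
  have i3s := (integrable_finsetSum Finset.univ fun j _ => i3k j).const_mul (1 / 6)
  have i23 : Integrable fun z : Euc n =>
      ∑ j, l j * (c * (z i * z j * Real.exp (-(quadForm H z / 2)))) - 1 / 6 * ∑ j, ∑ k, ∑ m,
        T j k m * (c * (z i * z j * z k * z m * Real.exp (-(quadForm H z / 2)))) := i2s.sub i3s
  constructor
  · simp_rw [e]
    exact i1.add i23
  intro S hS
  simp_rw [e]
  rw [integral_add i1 i23, integral_sub i2s i3s, integral_const_mul,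
    integral_coord_mul_exp_quadForm, mul_zero, zero_add, integral_const_mul,
    integral_finsetSum _ fun j _ => i2 j, integral_finsetSum _ fun j _ => i3k j]
  congr 1
  · simp only [integral_const_mul, hH.normalised_second_moment hc, Matrix.mulVec, dotProduct]
    exact Finset.sum_congr rfl fun j _ => mul_comm _ _
  · congr 1
    refine Finset.sum_congr rfl fun j _ => ?_
    rw [integral_finsetSum _ fun k _ => i3m j k]
    refine Finset.sum_congr rfl fun k _ => ?_
    rw [integral_finsetSum _ fun m _ => i3 j k m]
    refine Finset.sum_congr rfl fun m _ => ?_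
    rw [integral_const_mul, integral_const_mul, hH.normalised_fourth_moment hS hc]
    simp only [Finset.mul_sum, mul_assoc]

theorem mainTheorem2 {n : ℕ} {Ω : Type*} [MeasurableSpace Ω] (P : Measure Ω)
    [IsProbabilityMeasure P]
    -- drift, diffusion matrix and noise matrix `[2D]^{1/2}`
    (b : Euc n → Euc n) (hb : ContDiff ℝ 1 b)
    (D G : Matrix (Fin n) (Fin n) ℝ) (hG : G * Gᵀ = (2 : ℝ) • D)
    (B : ℝ≥0 → Ω → Euc n) (hB : IsStdBrownian P B)
    -- the diffusions `X_ε`, with `dX_ε = b(X_ε) ds + [2εD]^{1/2} dB`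
    (ε₀ : ℝ) (hε₀ : 0 < ε₀) (X : ℝ → ℝ → Ω → Euc n)
    (hX : ∀ ε ∈ Ioo 0 ε₀, IsSDESolution P B (fun _ x => b x) (√ε • G) (X ε))
    -- the deterministic trajectory
    (xhat : ℝ → Euc n) (hxhat : ∀ s, 0 ≤ s → HasDerivWithinAt xhat (b (xhat s)) (Ici 0) s)
    -- the linearised process `Z`, with `dZ = A(xhat) Z ds + [2D]^{1/2} dB`
    (Z : ℝ → Ω → Euc n)
    (hZ : IsSDESolution P B (fun s z => fderiv ℝ b (xhat s) z) G Z)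
    (hZ₀ : TendstoInMeasure P (fun (ε : ℝ) ω => (√ε)⁻¹ • (X ε 0 ω - xhat 0)) (𝓝[>] 0) (Z 0))
    -- the densities `p_ε(x, s)`, for times `s` in an interval `J`, solve the Fokker-Planck equation
    (J : Set ℝ) (hJ : J ⊆ Ici 0) (hJc : J.OrdConnected) (p : ℝ → Euc n → ℝ → ℝ)
    (hdens : ∀ ε ∈ Ioo 0 ε₀, ∀ s ∈ J, IsDensityOf P (X ε s) fun x => p ε x s)
    (hFP : ∀ ε ∈ Ioo 0 ε₀, SolvesFokkerPlanck b D ε (p ε) (interior J))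
    -- the expansion on the scale of the central limit theorem
    (phat₀ phat₁ : Euc n → ℝ → ℝ)
    (hCLT : ∀ s ∈ J, HasCLTExpansion (fun ε x => p ε x s) (xhat s)
      (fun z => phat₀ z s) (fun z => phat₁ z s))
    -- the WKB expansion
    (a : ℝ → ℝ → ℝ) (φ ω : Euc n → ℝ → ℝ)
    (hφ : ∀ s ∈ J, ContDiffAt ℝ 3 (fun x => φ x s) (xhat s))
    (hω : ∀ s ∈ J, ContDiffAt ℝ 1 (fun x => ω x s) (xhat s))
    (hωpos : ∀ s ∈ J, 0 < ω (xhat s) s)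
    (hWKB : ∀ s ∈ J, HasWKBExpansion (fun ε x => p ε x s) (fun ε => a ε s)
      (fun x => φ x s) (fun x => ω x s) (xhat s))
    (t : ℝ) (ht : t ∈ J) :
    -- `∇∇φ` is invertible (even positive definite), and `Σ(t) = [∇∇φ]⁻¹`
    (hessianMatrix (fun x => φ x t) (xhat t)).PosDef ∧
    covMatrix P (Z t) = (hessianMatrix (fun x => φ x t) (xhat t))⁻¹ ∧
    -- `Σ(t)` is the matrix of second moments of `phat₀`
    (∀ i j, Integrable (fun z : Euc n => z i * z j * phat₀ z t) ∧
      covMatrix P (Z t) i j = ∫ z : Euc n, z i * z j * phat₀ z t) ∧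
    -- `m(t) = [∇∇φ]⁻¹ ∇ ln ω - (1/6) ∇∇∇φ Θ`, for every square root `S Sᵀ = Ξ = [∇∇φ]⁻¹`
    (∀ i, Integrable fun z : Euc n => z i * phat₁ z t) ∧
    ∀ S : Matrix (Fin n) (Fin n) ℝ, S * Sᵀ = (hessianMatrix (fun x => φ x t) (xhat t))⁻¹ →
      ∀ i, ∫ z : Euc n, z i * phat₁ z t =
        ((hessianMatrix (fun x => φ x t) (xhat t))⁻¹ *ᵥ
            fun j => gradient (fun x => Real.log (ω x t)) (xhat t) j) i -
          1 / 6 * thirdDerivTheta (fun x => φ x t) (xhat t) S i := by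
  have ht0 : 0 ≤ t := hJ ht
  obtain ⟨ε, hε, hεmem, hlim⟩ := exists_seq_tendsto_ae_rescaled_deviation hb hε₀ hX hxhat hZ hZ₀
  have hq := (hCLT t ht).tendsto_cltScaled
  have hW := hWKB t ht
  have hZm : AEMeasurable (Z t) P := hZ.aemeasurable t ht0
  have hp₀ : ∀ z, 0 ≤ phat₀ z t := by
    intro z
    refine ge_of_tendsto (hq z) ?_
    filter_upwards [Ioo_mem_nhdsGT hε₀] with ε hε
    exact mul_nonneg (Real.rpow_nonneg hε.1.le _) ((hdens ε hε t ht).nonneg _)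
  have hlaw (hcont : Continuous fun z => phat₀ z t) :
      P.map (Z t) = volume.withDensity fun z => ENNReal.ofReal (phat₀ z t) :=
    map_eq_withDensity_of_tendsto_cltScaled hε (fun k => (hεmem k).1)
      (X := fun ε => X ε t) (fun k => hdens _ (hεmem k) t ht)
      (fun k => (hX _ (hεmem k)).aemeasurable t ht0) hZm (hlim t ht0) hq
      (fun R hR => hW.exists_eventually_abs_cltScaled_le hq (hφ t ht) (hω t ht) (hωpos t ht) R hR)
      hcont hp₀
  -- a nonzero gradient of `φ` would make the limit density vanish
  have hgrad : fderiv ℝ (fun x => φ x t) (xhat t) = 0 := by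
    by_contra hne
    have h0 : ∀ z, phat₀ z t = 0 := fun z =>
      hW.eq_zero_of_fderiv_ne_zero hq (hφ t ht) (hω t ht) (hωpos t ht) hne z
    have h1 := hlaw (by simp only [h0]; exact continuous_const)
    have : IsProbabilityMeasure (P.map (Z t)) := Measure.isProbabilityMeasure_map hZm
    simp only [h0, ENNReal.ofReal_zero, withDensity_const, zero_smul] at h1
    exact IsProbabilityMeasure.ne_zero (P.map (Z t)) h1
  have hcoef := hW.clt_coefficients (hCLT t ht) (hφ t ht) (hω t ht) (hωpos t ht) hgrad
  simp only [← quadForm_hessianMatrix] at hcoef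
  set H := hessianMatrix (fun x => φ x t) (xhat t)
  have hp₀eq : (fun z => phat₀ z t) = fun z => phat₀ 0 t * Real.exp (-(quadForm H z / 2)) :=
    funext fun z => (hcoef z).1
  have hlaw' := hlaw (by
    have := continuous_quadForm H
    rw [hp₀eq]
    fun_prop)
  rw [show (fun z => ENNReal.ofReal (phat₀ z t)) = fun z => ENNReal.ofReal
    (phat₀ 0 t * Real.exp (-(quadForm H z / 2))) from funext fun z => by rw [(hcoef z).1]] at hlaw'
  obtain ⟨hPD, hone, hcov⟩ :=
    posDef_and_covMatrix_eq_of_map_eq hZm (hφ t ht).hessianMatrix_isHermitian (hp₀ 0) hlaw'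
  have hcorr := hPD.integral_coord_mul_correction hone (phat₁ 0 t)
    (fun j => gradient (fun x => Real.log (ω x t)) (xhat t) j)
    (thirdPartial (fun x => φ x t) (xhat t)) (p₁ := fun z => phat₁ z t) (fun z => by
      have hg : fderiv ℝ (fun x => Real.log (ω x t)) (xhat t) z
          = ∑ j, gradient (fun x => Real.log (ω x t)) (xhat t) j * z j := by
        rw [← inner_gradient_left, PiLp.inner_apply]
        simp [mul_comm]
      rw [(hcoef z).2, (hcoef z).1, hg, iteratedFDeriv_three_diag])
  refine ⟨hPD, hcov, fun i j => ?_, fun i => (hcorr i).1, fun S hS i => (hcorr i).2 S hS⟩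
  have e : ∀ z : Euc n, z i * z j * phat₀ z t
      = phat₀ 0 t * (z i * z j * Real.exp (-(quadForm H z / 2))) := by
    intro z
    rw [(hcoef z).1]
    ring
  simp only [e]
  refine ⟨(hPD.integrable_coord_mul_coord i j).const_mul _, ?_⟩
  rw [integral_const_mul, hPD.normalised_second_moment hone, hcov]
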